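/- Let $p$ be a prime, let $K$ be a complete non-archimedean extension field of $\mathbb{Q}_p$ with absolute value $|\ |$ extending the $p$-adic one, and let $L\subseteq K$ be a finite extension of $\mathbb{Q}_p$ with prime element $\pi_L$, ring of integers $o_L$, and residue field with $q$ elements. Let $\mathrm{val}_L(x)=\log|x|/\log|\pi_L|$ for $x\in K^\times$, so that $\mathrm{val}_L(L^\times)=\mathbb{Z}$. Let $d\ge 0$, $G=GL_{d+1}(L)$, let $T\subseteq G$ be the torus of diagonal matrices $t=(t_1,\dots,t_{d+1})$, $T_0=T\cap GL_{d+1}(o_L)$, $\Lambda=T/T_0$ with projection $\lambda:T\to\Lambda$, and let $T'(K)=\mathrm{Hom}(\Lambda,K^\times)$. The Weyl group $W=S_{d+1}$ acts on $T$ by $({}^wt)_i=t_{w^{-1}(i)}$; the positive roots are those of the lower triangular Borel subgroup, $t\mapsto t_i/t_j$ for $j<i$. Let $\delta(t)=q^{\mathrm{val}_L(\Delta(t))}$ with $\Delta(t)=\prod_{j<i}t_i/t_j$. Let $\xi(t)=\prod_i t_i^{a_i}$ be a dominant integral weight, i.e. $a_1\le\dots\le a_{d+1}$ are integers. Put $$\gamma_\xi(w,\lambda(t))=\frac{\delta^{1/2}({}^wt)}{\delta^{1/2}(t)}\,\pi_L^{\mathrm{val}_L(\xi({}^wt))-\mathrm{val}_L(\xi(t))},$$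 where the first factor is the integral power of $q$ with exponent $\frac12(\mathrm{val}_L\Delta({}^wt)-\mathrm{val}_L\Delta(t))$, and put $\gamma_\xi^{dom}(\lambda(t))=\gamma_\xi(w,\lambda(t))$ for any $w\in W$ such that ${}^wt$ is antidominant, i.e. $|\alpha({}^wt)|\ge 1$ for all positive roots $\alpha$ (this does not depend on $w$). The $K$-points of the affinoid domain $T'_\xi$ are $$T'_\xi(K)=\{\zeta\in T'(K) : |\zeta(\mu)|\le|\gamma_\xi^{dom}(\mu)|\text{ for all }\mu\in\Lambda\}.$$ A point $\zeta\in T'(K)$ has the coordinates $\zeta_i=q^{i-1}\pi_L^{a_i}\zeta(\lambda_{\{i\}})\in K^\times$, $1\le i\le d+1$, where $\lambda_{\{i\}}\in\Lambda$ is the class of the diagonal matrix with $\pi_L$ at the place $i$ and $1$ elsewhere; via these coordinates $\zeta$ is viewed as the matrix $\mathrm{diag}(\zeta_1,\dots,\zeta_{d+1})\in GL_{d+1}(K)$. A filtered $K$-isocrystal $\underline{D}=(D,\varphi,Fil^\cdot D)$ consists of a finite dimensional $K$-vector space $D$, a $K$-linear automorphism $\varphi$ of $D$, and an exhaustive and separated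 decreasing filtration $(Fil^bD)_{b\in\mathbb{Z}}$ of $D$ by $K$-subspaces. Its type is the increasing sequence of the integers $b$ with $gr^bD\ne0$, each repeated $\dim_K gr^bD$ many times; its Frobenius type $s(\underline{D})$ is the conjugacy class of the semisimple part (in the Jordan decomposition) of $\varphi$. Put $t_H(\underline{D})=\sum_b b\cdot\dim_K gr^bD$ and $t_N^L(\underline{D})=\mathrm{val}_L(\det_K\varphi)$. Then $\underline{D}$ is weakly $L$-admissible if $t_H(\underline{D})=t_N^L(\underline{D})$ and $t_H(\underline{D}')\le t_N^L(\underline{D}')$ for every $\varphi$-invariant $K$-subspace $D'\subseteq D$ with the induced filtration. **Proposition.** Let $\zeta\in T'(K)$ and let $\xi=(a_1,\dots,a_{d+1})$ be a dominant integral weight of $G$. Then $\zeta\in T'_\xi(K)$ if and only if there is a weakly $L$-admissible filtered $K$-isocrystal $\underline{D}$ on $D=K^{d+1}$ of type $$\xi_L+\widetilde\eta_L=\big(a_i+(i-1)[L:\mathbb{Q}_p]\big)_{1\le i\le d+1}$$ and with $\zeta\in s(\underline{D})$. -/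

import Mathlib

/-! ### The base field, the normalized valuation, and the residue cardinality

Throughout `K` is a complete non-archimedean extension field of `ℚ_[p]` and
`L ⊆ K` is a finite extension of `ℚ_[p]`. -/

namespace BanachHecke

noncomputable section

section Valuation

variable {p : ℕ} [Fact p.Prime] {K : Type*} [NormedField K] [NormedAlgebra ℚ_[p] K]
  {L : IntermediateField ℚ_[p] K}

/-- `π` is a prime element of `L`: it generates the maximal ideal `{x | ‖x‖ < 1}` of the ring of
integers `{x | ‖x‖ ≤ 1}` of `L`. -/
def IsPrimeElement (π : Lˣ) : Prop :=
  ‖(π : L)‖ < 1 ∧ ∀ x : L, ‖x‖ < 1 → ‖x‖ ≤ ‖(π : L)‖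

/-- The additive valuation `val_L` on `K`, normalized by `val_L π = 1` for the prime element `π`
of `L`, so that `val_L(Lˣ) = ℤ`. -/
def valL (π : Lˣ) (x : K) : ℝ := Real.log ‖x‖ / Real.log ‖((π : L) : K)‖

/-- The restriction of `val_L` to `Lˣ` as an integer valued function. It takes integral values, so
that no rounding takes place: see `coe_ordL`. -/
def ordL (π : Lˣ) (x : Lˣ) : ℤ := ⌊valL π ((x : L) : K)⌋

theorem norm_prime_pos (π : Lˣ) : 0 < ‖((π : L) : K)‖ := by
  rw [norm_pos_iff]
  simp

theorem coe_ordL {π : Lˣ} (hπ : IsPrimeElement π) (x : Lˣ) :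
    (ordL π x : ℝ) = valL π ((x : L) : K) := by
  have h0 : 0 < ‖((π : L) : K)‖ := norm_prime_pos π
  have h1 : ‖((π : L) : K)‖ < 1 := hπ.1
  have hx : 0 < ‖((x : L) : K)‖ := norm_prime_pos x
  have hlog : Real.log ‖((π : L) : K)‖ < 0 := Real.log_neg h0 h1
  set n := ordL π x with hn
  have hle : (n : ℝ) ≤ valL π ((x : L) : K) := Int.floor_le _
  have hlt : valL π ((x : L) : K) < n + 1 := Int.lt_floor_add_one _
  have key : ‖((x * (π ^ n)⁻¹ : Lˣ) : L)‖ = ‖((x : L) : K)‖ * (‖((π : L) : K)‖ ^ n)⁻¹ := by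
    have e : ((x * (π ^ n)⁻¹ : Lˣ) : L) = (x : L) * ((π : L) ^ n)⁻¹ := by simp
    rw [e, norm_mul, norm_inv, norm_zpow]
    rfl
  have hpos : 0 < ‖((x * (π ^ n)⁻¹ : Lˣ) : L)‖ := by
    rw [key]; positivity
  have hlogy : Real.log ‖((x * (π ^ n)⁻¹ : Lˣ) : L)‖
      = Real.log ‖((x : L) : K)‖ - n * Real.log ‖((π : L) : K)‖ := by
    rw [key, Real.log_mul hx.ne' (by positivity), Real.log_inv, Real.log_zpow]
    ring
  rcases hle.eq_or_lt with h | h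
  · exact h
  · exfalso
    unfold valL at h hlt
    rw [lt_div_iff_of_neg hlog] at h
    rw [div_lt_iff_of_neg hlog] at hlt
    have hy1 : ‖((x * (π ^ n)⁻¹ : Lˣ) : L)‖ < 1 := by
      rw [← Real.log_neg_iff hpos, hlogy]; linarith
    have hy2 := Real.log_le_log hpos (hπ.2 _ hy1)
    rw [hlogy] at hy2
    have h3 : Real.log ‖(π : L)‖ = Real.log ‖((π : L) : K)‖ := rfl
    rw [h3] at hy2
    linarith

theorem ordL_mul {π : Lˣ} (hπ : IsPrimeElement π) (x y : Lˣ) :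
    ordL π (x * y) = ordL π x + ordL π y := by
  have hx : ‖((x : L) : K)‖ ≠ 0 := (norm_prime_pos x).ne'
  have hy : ‖((y : L) : K)‖ ≠ 0 := (norm_prime_pos y).ne'
  have : (ordL π (x * y) : ℝ) = ordL π x + ordL π y := by
    rw [coe_ordL hπ, coe_ordL hπ, coe_ordL hπ]
    simp only [valL, Units.val_mul, MulMemClass.coe_mul, norm_mul]
    rw [Real.log_mul hx hy, add_div]
  exact_mod_cast this

theorem ordL_congr (π : Lˣ) {x y : Lˣ} (h : ‖(x : L)‖ = ‖(y : L)‖) : ordL π x = ordL π y := by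
  have h' : ‖((x : L) : K)‖ = ‖((y : L) : K)‖ := h
  simp only [ordL, valL, h']

end Valuation

section Residue

variable {p : ℕ} [Fact p.Prime] {K : Type*} [NormedField K] [NormedAlgebra ℚ_[p] K]
  [IsUltrametricDist K]

/-- The number `q` of elements in the residue class field of `L`. -/
def residueCard (L : IntermediateField ℚ_[p] K) : ℕ :=
  Nat.card (IsLocalRing.ResidueField (NormedField.valuation (K := L)).valuationSubring)

end Residue

/-! ### The torus, its dual torus, the cocycle `γ_ξ` and the domain `T'_ξ(K)`

The group is `GL_n(L)` with the maximal torus `T` of diagonal matrices, the Borel subgroup of lower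
triangular matrices and the maximal compact subgroup `GL_n(o_L)`. The positive roots are
`t ↦ t i / t j` for `j < i`. -/

section Torus

variable {p : ℕ} [Fact p.Prime] {K : Type*} [NormedField K] [NormedAlgebra ℚ_[p] K]

/-- The group `T` of diagonal matrices in `GL_n(L)`. -/
abbrev Torus (L : IntermediateField ℚ_[p] K) (n : ℕ) : Type _ := Fin n → Lˣ

/-- `T₀ = T ∩ GL_n(o_L)`: the diagonal matrices whose entries are units of `o_L`. -/
def torusUnits (L : IntermediateField ℚ_[p] K) (n : ℕ) : Subgroup (Torus L n) where
  carrier := {t | ∀ i, ‖((t i : Lˣ) : L)‖ = 1}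
  mul_mem' := by
    intro s t hs ht i
    have := hs i
    have := ht i
    simp_all
  one_mem' := by intro i; simp
  inv_mem' := by
    intro t ht i
    have := ht i
    simp_all

/-- `Λ = T / T₀`, naturally identified with the cocharacter group of `T`. -/
abbrev Lam (L : IntermediateField ℚ_[p] K) (n : ℕ) : Type _ := Torus L n ⧸ torusUnits L n

/-- The projection `λ : T → Λ`. -/
def toLam (L : IntermediateField ℚ_[p] K) (n : ℕ) : Torus L n →* Lam L n :=
  QuotientGroup.mk' (torusUnits L n)

/-- The `K`-valued points of the dual torus, `T'(K) = Hom(Λ, Kˣ)`. -/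
abbrev DualTorus (L : IntermediateField ℚ_[p] K) (n : ℕ) : Type _ := Lam L n →* Kˣ

variable {L : IntermediateField ℚ_[p] K} {n : ℕ}

/-- The action `t ↦ ʷt` of the Weyl group on `T` (conjugation by the permutation matrix of `w`);
it moves the entry at the place `i` to the place `w i`. -/
def weylAct (w : Equiv.Perm (Fin n)) (t : Torus L n) : Torus L n := fun i => t (w⁻¹ i)

/-- `t ∈ T⁻⁻`: one has `|α(t)| ≥ 1` for every positive root `α`. -/
def IsAntidominant (t : Torus L n) : Prop :=
  ∀ i j : Fin n, j < i → 1 ≤ ‖((t i / t j : Lˣ) : L)‖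

/-- The algebraic character `ξ` of `T` given by `t ↦ ∏ i, t i ^ a i`. -/
def weight (a : Fin n → ℤ) (t : Torus L n) : Lˣ := ∏ i, t i ^ a i

/-- The determinant `Δ(t)` of the adjoint action of `t` on `Lie(N)`, `N` being the group of
lower triangular unipotent matrices: the product of the positive roots. -/
def adjointDet (t : Torus L n) : Lˣ := ∏ i, ∏ j ∈ Finset.Iio i, t i / t j

theorem isAntidominant_iff (t : Torus L n) :
    IsAntidominant t ↔ Monotone fun i => ‖((t i : Lˣ) : L)‖ := by
  have key : ∀ i j, 1 ≤ ‖((t i / t j : Lˣ) : L)‖ ↔ ‖((t j : Lˣ) : L)‖ ≤ ‖((t i : Lˣ) : L)‖ := by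
    intro i j
    have hj : 0 < ‖((t j : Lˣ) : L)‖ := norm_prime_pos (t j)
    rw [Units.val_div_eq_div_val, norm_div, one_le_div hj]
  simp only [IsAntidominant, key]
  rw [monotone_iff_forall_lt]
  exact ⟨fun h i j hij => h j i hij, fun h i j hij => h hij⟩

/-- Every Weyl group orbit in `T` meets `T⁻⁻`. -/
theorem exists_weylAct_isAntidominant (t : Torus L n) :
    ∃ w : Equiv.Perm (Fin n), IsAntidominant (weylAct w t) := by
  refine ⟨(Tuple.sort fun i => ‖((t i : Lˣ) : L)‖)⁻¹, ?_⟩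
  rw [isAntidominant_iff]
  exact Tuple.monotone_sort fun i => ‖((t i : Lˣ) : L)‖

variable [IsUltrametricDist K]

/-- The modulus character `δ(t) = |Δ(t)|_L⁻¹ = q ^ val_L(Δ(t))` of the Borel subgroup, restricted
to `T` and viewed in `K`. -/
def modulus (π : Lˣ) (t : Torus L n) : K := (residueCard L : K) ^ ordL π (adjointDet t)

/-- The quotient `δ^{1/2}(ʷt) / δ^{1/2}(t)`. The difference in the exponent is even, see
`even_ordL_adjointDet`, so the integer division by `2` is exact. -/
def modulusHalfRatio (π : Lˣ) (w : Equiv.Perm (Fin n)) (t : Torus L n) : K :=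
  (residueCard L : K) ^ ((ordL π (adjointDet (weylAct w t)) - ordL π (adjointDet t)) / 2)

/-- The cocycle
`γ_ξ(w, λ(t)) = δ^{1/2}(ʷt) / δ^{1/2}(t) * π ^ (val_L(ξ(ʷt)) - val_L(ξ(t)))`
as a function of `t ∈ T`. -/
def gammaXi (π : Lˣ) (a : Fin n → ℤ) (w : Equiv.Perm (Fin n)) (t : Torus L n) : K :=
  modulusHalfRatio π w t *
    ((π : L) : K) ^ (ordL π (weight a (weylAct w t)) - ordL π (weight a t))

/-- `γ_ξ^dom(λ(t)) = γ_ξ(w, λ(t))` for any `w` such that `ʷλ(t)` is antidominant. The value does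
not depend on the choice of `w`, see `gammaDom_eq`. -/
def gammaDom (π : Lˣ) (a : Fin n → ℤ) (t : Torus L n) : K :=
  gammaXi π a (exists_weylAct_isAntidominant t).choose t

/-- The set `T'_ξ(K)` of all `ζ ∈ T'(K)` such that `|ζ(λ)| ≤ |γ_ξ^dom(λ)|` for all `λ ∈ Λ`. -/
def affinoidDomain (π : Lˣ) (a : Fin n → ℤ) : Set (DualTorus L n) :=
  {ζ | ∀ t : Torus L n, ‖((ζ (toLam L n t) : Kˣ) : K)‖ ≤ ‖gammaDom π a t‖}

/-- The coordinates `ζ_i = q^{i-1} π^{a_i} ζ(λ_{i})` (`i = 1, …, n`; here `i` starts at `0`) of a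
point `ζ ∈ T'(K)`, where `λ_{i}` is the class of the diagonal matrix with entry `π` at the place
`i` and entries `1` elsewhere. -/
def coord (π : Lˣ) (a : Fin n → ℤ) (ζ : DualTorus L n) (i : Fin n) : K :=
  (residueCard L : K) ^ (i : ℕ) * ((π : L) : K) ^ a i *
    ((ζ (toLam L n (Pi.mulSingle i π)) : Kˣ) : K)

end Torus

/-! ### Well-definedness of the half-integral powers and of `γ_ξ^dom` -/

section WellDefined

variable {p : ℕ} [Fact p.Prime] {K : Type*} [NormedField K] [NormedAlgebra ℚ_[p] K]
  {L : IntermediateField ℚ_[p] K} {n : ℕ}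

theorem ordL_one {π : Lˣ} (hπ : IsPrimeElement π) : ordL π (1 : Lˣ) = 0 := by
  have := ordL_mul hπ (1 : Lˣ) 1
  simp at this
  exact this

/-- `val_L` on `Lˣ` as a homomorphism. -/
def ordLHom {π : Lˣ} (hπ : IsPrimeElement π) : Lˣ →* Multiplicative ℤ where
  toFun x := Multiplicative.ofAdd (ordL π x)
  map_one' := by rw [ordL_one hπ]; rfl
  map_mul' x y := by rw [ordL_mul hπ]; rfl

theorem ordL_prod {ι : Type*} {π : Lˣ} (hπ : IsPrimeElement π) (s : Finset ι) (f : ι → Lˣ) :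
    ordL π (∏ i ∈ s, f i) = ∑ i ∈ s, ordL π (f i) := by
  classical
  induction s using Finset.induction_on with
  | empty => simp [ordL_one hπ]
  | insert b s hb ih => rw [Finset.prod_insert hb, Finset.sum_insert hb, ordL_mul hπ, ih]

theorem ordL_div {π : Lˣ} (hπ : IsPrimeElement π) (x y : Lˣ) :
    ordL π (x / y) = ordL π x - ordL π y := by
  have := ordL_mul hπ (x / y) y
  rw [div_mul_cancel] at this
  omega

theorem ordL_adjointDet {π : Lˣ} (hπ : IsPrimeElement π) (t : Torus L n) :
    ordL π (adjointDet t) =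
      ∑ i, ∑ j ∈ Finset.Iio i, (ordL π (t i) - ordL π (t j)) := by
  simp only [adjointDet, ordL_prod hπ, ordL_div hπ]

theorem ordL_adjointDet_modEq {π : Lˣ} (hπ : IsPrimeElement π) (t : Torus L n) :
    ordL π (adjointDet t) ≡ ((n : ℤ) - 1) * ∑ i, ordL π (t i) [ZMOD 2] := by
  rw [ordL_adjointDet hπ]
  set m : Fin n → ℤ := fun i => ordL π (t i)
  have h1 : ∑ i, ∑ j ∈ Finset.Iio i, (m i - m j)
      = ∑ i, ∑ j ∈ Finset.Iio i, m i
        - ∑ i, ∑ j ∈ Finset.Iio i, m j := by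
    simp only [Finset.sum_sub_distrib]
  have h2 : ∑ i, ∑ j ∈ Finset.Iio i, m j
      = ∑ i, ∑ j ∈ Finset.Ioi i, m i := by
    refine Finset.sum_comm' fun i j => ?_
    simp
  have h3 : ∑ i, ∑ j ∈ Finset.Iio i, m i
      + ∑ i, ∑ j ∈ Finset.Ioi i, m i = ((n : ℤ) - 1) * ∑ i, m i := by
    rw [← Finset.sum_add_distrib, Finset.mul_sum]
    refine Finset.sum_congr rfl fun i _ => ?_
    simp only [Finset.sum_const, Fin.card_Iio, Fin.card_Ioi, nsmul_eq_mul]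
    rw [← add_mul]
    congr 1
    have := i.2
    omega
  rw [h1, h2]
  refine Int.ModEq.symm ((Int.modEq_iff_dvd).2 ?_)
  rw [← h3]
  exact ⟨-∑ i, ∑ j ∈ Finset.Ioi i, m i, by ring⟩

/-- The exponent in `modulusHalfRatio` is divisible by `2` before the division. -/
theorem even_ordL_adjointDet {π : Lˣ} (hπ : IsPrimeElement π) (w : Equiv.Perm (Fin n))
    (t : Torus L n) :
    2 ∣ ordL π (adjointDet (weylAct w t)) - ordL π (adjointDet t) := by
  have h1 := ordL_adjointDet_modEq hπ t
  have h2 := ordL_adjointDet_modEq hπ (weylAct w t)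
  have h3 : ∑ i, ordL π (weylAct w t i) = ∑ i, ordL π (t i) :=
    Equiv.sum_comp w⁻¹ fun i => ordL π (t i)
  rw [h3] at h2
  exact (Int.modEq_iff_dvd).1 (h1.trans h2.symm)

variable [IsUltrametricDist K]

/-- `modulusHalfRatio` is a square root of `δ(ʷt) / δ(t)`. -/
theorem modulusHalfRatio_sq {π : Lˣ} (hπ : IsPrimeElement π) (hq : (residueCard L : K) ≠ 0)
    (w : Equiv.Perm (Fin n)) (t : Torus L n) :
    modulusHalfRatio π w t ^ 2 = modulus π (weylAct w t) / modulus π t := by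
  rw [modulusHalfRatio, modulus, modulus, ← zpow_sub₀ hq, ← zpow_natCast, ← zpow_mul]
  congr 1
  exact Int.ediv_mul_cancel (even_ordL_adjointDet hπ w t)

/-- Two elements of `T` with entrywise equal norms have the same values of `γ_ξ`. -/
theorem gammaXi_congr (π : Lˣ) (a : Fin n → ℤ) {v w : Equiv.Perm (Fin n)} {t : Torus L n}
    (h : ∀ i, ‖((weylAct v t i : Lˣ) : L)‖ = ‖((weylAct w t i : Lˣ) : L)‖) :
    gammaXi π a v t = gammaXi π a w t := by
  have h1 : ordL π (adjointDet (weylAct v t)) = ordL π (adjointDet (weylAct w t)) := by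
    apply ordL_congr
    simp only [adjointDet, Units.coe_prod, Units.val_div_eq_div_val, norm_prod, norm_div, h]
  have h2 : ordL π (weight a (weylAct v t)) = ordL π (weight a (weylAct w t)) := by
    apply ordL_congr
    simp only [weight, Units.coe_prod, Units.val_zpow_eq_zpow_val, norm_prod, norm_zpow, h]
  simp only [gammaXi, modulusHalfRatio, h1, h2]

theorem gammaDom_eq (π : Lˣ) (a : Fin n → ℤ) (t : Torus L n) (w : Equiv.Perm (Fin n))
    (hw : IsAntidominant (weylAct w t)) : gammaDom π a t = gammaXi π a w t := by
  have hv := (exists_weylAct_isAntidominant t).choose_spec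
  set v := (exists_weylAct_isAntidominant t).choose with hv_def
  refine gammaXi_congr π a fun i => ?_
  rw [isAntidominant_iff] at hv hw
  have e1 := (Tuple.comp_sort_eq_comp_iff_monotone
    (f := fun i => ‖((t i : Lˣ) : L)‖) (σ := v⁻¹)).2 hv
  have e2 := (Tuple.comp_sort_eq_comp_iff_monotone
    (f := fun i => ‖((t i : Lˣ) : L)‖) (σ := w⁻¹)).2 hw
  exact congrFun (e1.trans e2.symm) i

end WellDefined

/-! ### Filtered isocrystals -/

section Isocrystal

/-- A filtered `K`-isocrystal with underlying (finite dimensional) `K`-vector space `V`: a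
`K`-linear automorphism of `V` and an exhaustive and separated decreasing filtration of `V` by
`K`-subspaces. -/
structure FilteredIsocrystal (K V : Type*) [Field K] [AddCommGroup V] [Module K V] where
  /-- the Frobenius -/
  frob : V ≃ₗ[K] V
  /-- the filtration -/
  fil : ℤ → Submodule K V
  antitone_fil : Antitone fil
  exhaustive : ∀ x : V, ∃ i, x ∈ fil i
  separated : ∀ x : V, (∀ i, x ∈ fil i) → x = 0

namespace FilteredIsocrystal

variable {K V : Type*} [Field K] [AddCommGroup V] [Module K V]

/-- `dim_K gr^b D`, where `gr^b D = Fil^b D / Fil^{b+1} D`. -/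
def grDim (D : FilteredIsocrystal K V) (b : ℤ) : ℕ :=
  Module.finrank K (D.fil b ⧸ (D.fil (b + 1)).comap (D.fil b).subtype)

/-- `t_H(D) = ∑_b b * dim_K gr^b D` (a sum with finitely many non-zero terms). -/
def tH (D : FilteredIsocrystal K V) : ℤ := ∑ᶠ b : ℤ, b * (D.grDim b : ℤ)

/-- `b = type(D)`: the sequence `b` is increasing and consists of the break points of the
filtration, each repeated `dim_K gr D` many times. -/
def HasType (D : FilteredIsocrystal K V) {n : ℕ} (b : Fin n → ℤ) : Prop :=
  Monotone b ∧ ∀ c : ℤ, D.grDim c = (Finset.univ.filter fun i => b i = c).card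

/-- The isocrystal on a Frobenius-invariant subspace `W`, with the induced filtration. -/
def restrict [FiniteDimensional K V] (D : FilteredIsocrystal K V) (W : Submodule K V)
    (hW : ∀ x ∈ W, D.frob x ∈ W) : FilteredIsocrystal K W where
  frob := LinearEquiv.ofInjectiveEndo ((D.frob : V →ₗ[K] V).restrict hW) (by
    intro x y h
    apply Subtype.ext
    apply D.frob.injective
    exact congrArg Subtype.val h)
  fil i := (D.fil i).comap W.subtype
  antitone_fil := fun _ _ hij => Submodule.comap_mono (D.antitone_fil hij)
  exhaustive x := D.exhaustive x
  separated x hx := Subtype.ext (D.separated x hx)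

end FilteredIsocrystal

/-- `s` is the semisimple part of the endomorphism `f`, i.e. `f = s + ν` is the Jordan
decomposition: `s` is semisimple, `ν` is nilpotent, and `s` and `ν` commute. -/
def IsSemisimplePart {K V : Type*} [Field K] [AddCommGroup V] [Module K V]
    (f s : Module.End K V) : Prop :=
  s.IsSemisimple ∧ IsNilpotent (f - s) ∧ Commute s (f - s)

/-- The Frobenius type `s(D)`: the conjugacy class, under the group of `K`-linear automorphisms of
`V`, of the semisimple part of the Frobenius. -/
def FilteredIsocrystal.frobeniusType {K V : Type*} [Field K] [AddCommGroup V] [Module K V]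
    (D : FilteredIsocrystal K V) : Set (Module.End K V) :=
  {g | ∃ s : Module.End K V, IsSemisimplePart (D.frob : V →ₗ[K] V) s ∧ IsConj s g}

section Admissible

variable {p : ℕ} [Fact p.Prime] {K : Type*} [NormedField K] [NormedAlgebra ℚ_[p] K]
  {L : IntermediateField ℚ_[p] K} {V : Type*} [AddCommGroup V] [Module K V]

/-- `t_N^L(D) = val_L(det_K(φ))`. -/
def FilteredIsocrystal.tN (D : FilteredIsocrystal K V) (π : Lˣ) : ℝ :=
  valL π (LinearMap.det (D.frob : V →ₗ[K] V))

/-- `D` is weakly `L`-admissible. -/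
def FilteredIsocrystal.IsWeaklyAdmissible [FiniteDimensional K V] (D : FilteredIsocrystal K V)
    (π : Lˣ) : Prop :=
  (D.tH : ℝ) = D.tN π ∧
    ∀ (W : Submodule K V) (hW : ∀ x ∈ W, D.frob x ∈ W),
      ((D.restrict W hW).tH : ℝ) ≤ (D.restrict W hW).tN π

end Admissible

end Isocrystal

end

end BanachHecke

/-! With places counted from 1, put b_i = a_i + (i-1)[L:ℚ_p] and s_i = val_L(ζ_i). Both sides of the
equivalence say the same thing: for every set A of places, the sum of the |A| smallest b_i is at
most the sum of the s_i over A, with equality for the full set. In other words, the Hodge polygon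
lies below the Newton polygon and they share an endpoint.

For the affinoid domain, val_L(q) = [L:ℚ_p] (`norm_residueCard`). Hence, at an element of T with
valuations m_i, γ_ξ(w, ·) has valuation ∑ b_i (m_{w⁻¹i} - m_i), and the normalization of the
coordinates ζ_i absorbs the subtracted half. Membership becomes ∑ b_i m_{w⁻¹i} ≤ ∑ s_i m_i for all
integral m, where w sorts m decreasingly. Indicator vectors and Abel summation turn this into the
polygon condition (`forall_sum_mul_le_iff`).

An admissible isocrystal gives the inequalities because every subfamily of eigenvalues is realized
on an invariant subspace (`exists_invariant_det_restrict_eq_prod`), and t_H of a subspace of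
dimension k is at least the sum of the k smallest b_i, the value in general position
(`HasType.sum_le_tH_restrict`).

Conversely, a flag is needed in general position to all invariant subspaces at once. A diagonal
Frobenius with a repeated eigenvalue admits none, since every hyperplane then contains an eigenline.
The bidiagonal map e_i ↦ ζ_i e_i + e_{i+1}, with the flag spanned by initial basis vectors, does the
job (`finrank_inf_headSubspace_le`). Its semisimple part is still conjugate to diag(ζ), and its
determinants on invariant subspaces are products of subfamilies of the ζ_i. -/

open BanachHecke Module

/-! ### Absolute value of the residue cardinality of a local field -/

section LocalField

variable {p : ℕ} [Fact p.Prime] {F : Type*} [NormedField F] [NormedAlgebra ℚ_[p] F]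

/-- If ‖x‖ > 1, the leading term of a monic integral equation strictly dominates all others.
Conversely, the norm is the spectral norm, so ‖x‖ ≤ 1 bounds every coefficient of the minimal
polynomial by 1. -/
theorem isIntegral_padicInt_iff_norm_le_one [IsUltrametricDist F] [Algebra.IsAlgebraic ℚ_[p] F]
    [Algebra ℤ_[p] F] [IsScalarTower ℤ_[p] ℚ_[p] F] (x : F) :
    IsIntegral ℤ_[p] x ↔ ‖x‖ ≤ 1 := by
  constructor
  · rintro ⟨P, hP, h0⟩
    by_contra! hx
    have hcoef : ∀ i, ‖algebraMap ℤ_[p] F (P.coeff i)‖ ≤ 1 := fun i => by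
      rw [IsScalarTower.algebraMap_apply ℤ_[p] ℚ_[p] F, norm_algebraMap']
      exact PadicInt.norm_le_one _
    rw [Polynomial.eval₂_eq_sum_range, Finset.sum_range_succ, hP.coeff_natDegree, map_one,
      one_mul, add_comm] at h0
    have h1 := eq_neg_of_add_eq_zero_left h0
    have h2 : ‖x ^ P.natDegree‖
        = ‖∑ i ∈ Finset.range P.natDegree, algebraMap ℤ_[p] F (P.coeff i) * x ^ i‖ := by
      rw [h1, norm_neg]
    rcases Nat.eq_zero_or_pos P.natDegree with hd | hd
    · rw [hd] at h2; simp at h2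
    have h3 : ‖∑ i ∈ Finset.range P.natDegree, algebraMap ℤ_[p] F (P.coeff i) * x ^ i‖
        ≤ ‖x‖ ^ (P.natDegree - 1) := by
      refine IsUltrametricDist.norm_sum_le_of_forall_le_of_nonneg (by positivity) fun i hi => ?_
      rw [norm_mul, norm_pow]
      calc _ ≤ 1 * ‖x‖ ^ i := by gcongr; exact hcoef i
        _ ≤ ‖x‖ ^ (P.natDegree - 1) := by
          rw [one_mul]
          exact pow_le_pow_right₀ hx.le (by have := Finset.mem_range.1 hi; omega)
    rw [← h2, norm_pow] at h3
    exact absurd h3 (not_le.2 (pow_lt_pow_right₀ hx (by omega)))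
  · intro hx
    rw [NormedAlgebra.norm_eq_spectralNorm ℚ_[p] x, spectralNorm,
      spectralValue_le_one_iff (minpoly.monic (Algebra.IsIntegral.isIntegral x))] at hx
    have hl : minpoly ℚ_[p] x ∈ Polynomial.lifts (algebraMap ℤ_[p] ℚ_[p]) := by
      rw [Polynomial.lifts_iff_coeff_lifts]
      exact fun n => ⟨⟨_, hx n⟩, rfl⟩
    obtain ⟨P, hP, -, hmon⟩ := Polynomial.lifts_and_degree_eq_and_monic hl
      (minpoly.monic (Algebra.IsIntegral.isIntegral x))
    refine ⟨P, hmon, ?_⟩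
    rw [IsScalarTower.algebraMap_eq ℤ_[p] ℚ_[p] F, ← Polynomial.eval₂_map, hP]
    exact minpoly.aeval ℚ_[p] x

theorem Ideal.card_quotient_span_singleton_prime (R : Type*) [CommRing R] [Algebra ℤ_[p] R]
    [Module.Free ℤ_[p] R] [Module.Finite ℤ_[p] R] :
    Nat.card (R ⧸ Ideal.span {(p : R)}) = p ^ Module.finrank ℤ_[p] R := by
  have hp : Nat.card (ℤ_[p] ⧸ IsLocalRing.maximalIdeal ℤ_[p]) = p := by
    have := Nat.card_congr (PadicInt.residueField (p := p)).toEquiv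
    rw [Nat.card_zmod] at this
    exact this
  have e : Ideal.span {(p : R)} = (IsLocalRing.maximalIdeal ℤ_[p]).map (algebraMap ℤ_[p] R) := by
    rw [PadicInt.maximalIdeal_eq_span_p, Ideal.map_span, Set.image_singleton, map_natCast]
  let := Ideal.Quotient.field (IsLocalRing.maximalIdeal ℤ_[p])
  rw [e, ← IsLocalRing.finrank_quotient_map (R := ℤ_[p]) (S := R)]
  have : Module.Finite (ℤ_[p] ⧸ IsLocalRing.maximalIdeal ℤ_[p])
      (R ⧸ (IsLocalRing.maximalIdeal ℤ_[p]).map (algebraMap ℤ_[p] R)) :=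
    Module.Finite.of_restrictScalars_finite ℤ_[p] _ _
  rw [Module.natCard_eq_pow_finrank (K := ℤ_[p] ⧸ IsLocalRing.maximalIdeal ℤ_[p]), hp]

/-- If `‖ϖ‖` generates the value group, then a residue field with `q` elements satisfies
`‖q‖ = ‖ϖ‖ ^ [F : ℚ_p]`. -/
theorem norm_card_residueField [IsUltrametricDist F] [FiniteDimensional ℚ_[p] F] {ϖ : F}
    (h0 : ϖ ≠ 0) (h1 : ‖ϖ‖ < 1) (hmax : ∀ x : F, ‖x‖ < 1 → ‖x‖ ≤ ‖ϖ‖)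
    {e : ℕ} (he : ‖(p : F)‖ = ‖ϖ‖ ^ e) :
    ‖(Nat.card (IsLocalRing.ResidueField (NormedField.valuation (K := F)).valuationSubring) : F)‖
      = ‖ϖ‖ ^ Module.finrank ℚ_[p] F := by
  set O := (NormedField.valuation (K := F)).valuationSubring with hO
  have memO : ∀ x : F, x ∈ O ↔ ‖x‖ ≤ 1 := fun x => by
    rw [hO, Valuation.mem_valuationSubring_iff]; rfl
  let : Algebra ℤ_[p] F := ((algebraMap ℚ_[p] F).comp (algebraMap ℤ_[p] ℚ_[p])).toAlgebra
  have : IsScalarTower ℤ_[p] ℚ_[p] F := IsScalarTower.of_algebraMap_eq fun _ => rfl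
  let : Algebra ℤ_[p] O := ((algebraMap ℤ_[p] F).codRestrict O fun x => by
    rw [memO, IsScalarTower.algebraMap_apply ℤ_[p] ℚ_[p] F, norm_algebraMap']
    exact PadicInt.norm_le_one _).toAlgebra
  have : IsScalarTower ℤ_[p] O F := IsScalarTower.of_algebraMap_eq fun _ => rfl
  -- Identifying the unit ball with the integral closure of ℤ_p makes it free over ℤ_p of rank [F :
  -- ℚ_p].
  have : IsIntegralClosure O ℤ_[p] F :=
    { algebraMap_injective := Subtype.val_injective
      isIntegral_iff := fun {x} => by
        rw [isIntegral_padicInt_iff_norm_le_one, ← memO]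
        exact ⟨fun h => ⟨⟨x, h⟩, rfl⟩, by rintro ⟨y, rfl⟩; exact y.2⟩ }
  have : Module.IsTorsionFree ℤ_[p] F := Module.IsTorsionFree.trans_faithfulSMul ℤ_[p] ℚ_[p] F
  have : Module.Finite ℤ_[p] O := IsIntegralClosure.finite ℤ_[p] ℚ_[p] F O
  have : Module.Free ℤ_[p] O := IsIntegralClosure.module_free ℤ_[p] ℚ_[p] F O
  have : IsDedekindDomain O := IsIntegralClosure.isDedekindDomain ℤ_[p] ℚ_[p] F O
  have hrank := IsIntegralClosure.rank ℤ_[p] ℚ_[p] F O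
  have hcard := Ideal.card_quotient_span_singleton_prime (p := p) O
  set w : O := ⟨ϖ, (memO ϖ).2 h1.le⟩
  have hdvd : ∀ x y : O, ‖(x : F)‖ ≤ ‖(y : F)‖ → y ∣ x := fun x y hxy => by
    by_cases hy : (y : F) = 0
    · have : (x : F) = 0 := by simpa [hy] using hxy
      have : x = 0 := Subtype.ext this
      simp [this]
    · have hy' : 0 < ‖(y : F)‖ := norm_pos_iff.2 hy
      refine ⟨⟨x / y, (memO _).2 ?_⟩, Subtype.ext ?_⟩
      · rw [norm_div]; exact (div_le_one hy').2 hxy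
      · exact (mul_div_cancel₀ (x : F) hy).symm
  have hunit : ∀ x : O, IsUnit x ↔ ‖(x : F)‖ = 1 := fun x => by
    rw [isUnit_iff_dvd_one]
    refine ⟨?_, fun h => hdvd 1 x (by rw [h, OneMemClass.coe_one, norm_one])⟩
    rintro ⟨y, hy⟩
    have h2 : (1 : ℝ) = ‖(x : F)‖ * ‖(y : F)‖ := by
      rw [← norm_mul, ← MulMemClass.coe_mul, ← hy, OneMemClass.coe_one, norm_one]
    have hx := (memO x).1 x.2
    have hy := (memO y).1 y.2
    nlinarith [norm_nonneg (x : F)]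
  have hm : IsLocalRing.maximalIdeal O = Ideal.span {w} := by
    ext x
    rw [IsLocalRing.mem_maximalIdeal, mem_nonunits_iff, hunit, Ideal.mem_span_singleton]
    have hx1 := (memO x).1 x.2
    constructor
    · exact fun h => hdvd x w (hmax _ (lt_of_le_of_ne hx1 h))
    · rintro ⟨y, rfl⟩ h
      have : ‖((w * y : O) : F)‖ = ‖ϖ‖ * ‖(y : F)‖ := norm_mul _ _
      have hy := (memO y).1 y.2
      nlinarith [norm_nonneg ϖ]
  have hpe : Ideal.span {(p : O)} = IsLocalRing.maximalIdeal O ^ e := by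
    rw [hm, Ideal.span_singleton_pow, Ideal.span_singleton_eq_span_singleton]
    have hwe : ‖((w ^ e : O) : F)‖ = ‖((p : O) : F)‖ := by
      rw [show ((p : O) : F) = (p : F) by simp, he, ← norm_pow]; rfl
    exact associated_of_dvd_dvd (hdvd _ _ hwe.le) (hdvd _ _ hwe.ge)
  have hm0 : IsLocalRing.maximalIdeal O ≠ ⊥ := by
    rw [hm, Ne, Ideal.span_singleton_eq_bot]
    exact fun h => h0 (congrArg Subtype.val h)
  -- Count O/pO = O/𝔪^e twice: p^[F:ℚ_p] = q^e. Taking norms with ‖p‖ = ‖ϖ‖^e and extracting e-th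
  -- roots gives the claim.
  have hq := cardQuot_pow_of_prime (P := IsLocalRing.maximalIdeal O) hm0 (i := e)
  rw [Submodule.cardQuot_apply, Submodule.cardQuot_apply, ← hpe, hcard, hrank] at hq
  have hp1 : ‖(p : F)‖ < 1 := by
    rw [← map_natCast (algebraMap ℚ_[p] F), norm_algebraMap']
    exact Padic.norm_p_lt_one
  have he0 : e ≠ 0 := by rintro rfl; simp [he] at hp1
  have := congrArg (fun k : ℕ => ‖(k : F)‖) hq
  simp only [Nat.cast_pow, norm_pow, he] at this
  rw [← pow_mul, mul_comm, pow_mul] at this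
  exact (pow_left_inj₀ (by positivity) (by positivity) he0).1 this.symm

end LocalField

/-! ### Majorization inequalities -/

section Majorization

theorem card_filter_val_lt {n k : ℕ} (hk : k ≤ n) :
    (Finset.univ.filter fun i : Fin n => (i : ℕ) < k).card = k := by
  rw [Fin.card_filter_val_lt, min_eq_right hk]

/-- Among all sets of a given size, an initial segment minimizes the sum of a monotone family. -/
theorem Monotone.sum_filter_lt_card_le_sum {n : ℕ} {b : Fin n → ℝ} (hb : Monotone b)
    (I : Finset (Fin n)) :
    ∑ i with Fin.val i < I.card, b i ≤ ∑ i ∈ I, b i := by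
  rcases Nat.eq_zero_or_pos I.card with h | h
  · rw [Finset.card_eq_zero.1 h]; simp
  have hn : I.card ≤ n := by simpa using Finset.card_le_univ I
  set J := Finset.univ.filter fun i : Fin n => (i : ℕ) < I.card with hJ
  have hcard : J.card = I.card := card_filter_val_lt hn
  -- Subtracting the last value on the initial segment J makes the terms nonpositive on J and
  -- nonnegative off J. Both sets have the same size, so the shift does not affect the comparison.
  set c := b ⟨I.card - 1, by omega⟩
  have h1 : ∑ i ∈ J, (b i - c) ≤ ∑ i ∈ I, (b i - c) := by
    calc ∑ i ∈ J, (b i - c) ≤ ∑ i ∈ J ∩ I, (b i - c) := by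
          rw [← Finset.sum_inter_add_sum_sdiff J I]
          refine add_le_of_nonpos_right (Finset.sum_nonpos fun i hi => sub_nonpos.2 (hb ?_))
          simp only [hJ, Finset.mem_sdiff, Finset.mem_filter] at hi
          exact Fin.le_def.2 (by simp; omega)
      _ ≤ ∑ i ∈ I, (b i - c) := by
          refine Finset.sum_le_sum_of_subset_of_nonneg Finset.inter_subset_right fun i hi hi' => ?_
          have : ¬ (i : ℕ) < I.card := fun h => hi' (by simp [hJ, h, hi])
          exact sub_nonneg.2 (hb (Fin.le_def.2 (by simp; omega)))
  simp only [Finset.sum_sub_distrib, Finset.sum_const, hcard] at h1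
  linarith

/-- Abel summation: an antitone family pairs nonnegatively, up to the boundary term, with a family
whose partial sums are nonnegative. -/
theorem Antitone.mul_sum_le_sum_mul {n : ℕ} {m c : Fin (n + 1) → ℝ} (hm : Antitone m)
    (hc : ∀ k : ℕ, 0 ≤ ∑ i with Fin.val i < k, c i) :
    m (Fin.last n) * ∑ i, c i ≤ ∑ i, m i * c i := by
  induction n with
  | zero => simp
  | succ n ih =>
    have hc' : ∀ k : ℕ, 0 ≤ ∑ i with Fin.val i < k, c i.castSucc := fun k => by
      -- Capping k at n + 1 keeps the last place out of the partial sum.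
      have := hc (min k (n + 1))
      rw [Finset.sum_filter, Fin.sum_univ_castSucc] at this
      rw [Finset.sum_filter]
      simpa [Fin.is_le] using this
    have h := ih (m := fun i => m i.castSucc) (c := fun i => c i.castSucc)
      (fun i j hij => hm (Fin.castSucc_le_castSucc_iff.2 hij)) hc'
    rw [Fin.sum_univ_castSucc, Fin.sum_univ_castSucc (fun i => m i * c i), mul_add]
    have h0 : 0 ≤ ∑ i : Fin (n + 1), c i.castSucc := by simpa [Fin.is_le] using hc' (n + 1)
    have := mul_le_mul_of_nonneg_right (hm (Fin.le_last (Fin.castSucc (Fin.last n)))) h0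
    linarith

/-- Indicator vectors of sets A test the partial sums, and the constant vector -1 gives the missing
half of the total equality. These test vectors suffice because a decreasing m pairs with partial
sums by Abel summation, whose boundary term vanishes when the totals agree. -/
theorem forall_sum_mul_le_iff {n : ℕ} {b s : Fin (n + 1) → ℝ} (hb : Monotone b) :
    (∀ (m : Fin (n + 1) → ℤ) (w : Equiv.Perm (Fin (n + 1))), Antitone (fun i => m (w⁻¹ i)) →
      ∑ i, b i * m (w⁻¹ i) ≤ ∑ i, s i * m i) ↔
    (∀ A : Finset (Fin (n + 1)), ∑ i with Fin.val i < A.card, b i ≤ ∑ i ∈ A, s i) ∧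
      ∑ i, s i = ∑ i, b i := by
  constructor
  · intro h
    have hA : ∀ A : Finset (Fin (n + 1)), ∑ i with Fin.val i < A.card, b i ≤ ∑ i ∈ A, s i := by
      intro A
      set m : Fin (n + 1) → ℤ := fun i => if i ∈ A then 1 else 0
      -- Sorting -m increasingly puts the ones of the indicator first.
      set σ := Tuple.sort (fun i => -m i)
      have h1 := h m σ⁻¹ (fun i j hij => by
        have := Tuple.monotone_sort (fun i => -m i) hij
        simp only [Function.comp_apply, neg_le_neg_iff] at this
        simpa using this)
      have h2 : ∑ i, s i * m i = ∑ i ∈ A, s i := by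
        simp [m, Finset.sum_ite_mem]
      have h3 : ∑ i, b i * m (σ⁻¹⁻¹ i) = ∑ i ∈ A.map σ⁻¹.toEmbedding, b i := by
        rw [Finset.sum_map, ← Equiv.sum_comp σ⁻¹]
        simp [m, Finset.sum_ite_mem]
      have h4 := hb.sum_filter_lt_card_le_sum (A.map σ⁻¹.toEmbedding)
      rw [Finset.card_map] at h4
      linarith
    refine ⟨hA, le_antisymm ?_ ?_⟩
    · have := h (fun _ => -1) 1 (fun _ _ _ => le_rfl)
      simpa using this
    · have := hA Finset.univ
      simpa [Fin.is_le] using this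
  · rintro ⟨hA, htot⟩ m w hm
    have e : ∑ i, s i * m i = ∑ i, s (w⁻¹ i) * m (w⁻¹ i) :=
      (Equiv.sum_comp w⁻¹ fun i => s i * (m i : ℝ)).symm
    have ht : ∑ i, s (w⁻¹ i) = ∑ i, s i := Equiv.sum_comp w⁻¹ s
    have key := Antitone.mul_sum_le_sum_mul (m := fun i => (m (w⁻¹ i) : ℝ))
      (c := fun i => s (w⁻¹ i) - b i) (fun i j hij => Int.cast_le.2 (hm hij)) (fun k => by
        rw [Finset.sum_sub_distrib, sub_nonneg]
        have hmin : ∀ i : Fin (n + 1), (i : ℕ) < k ↔ (i : ℕ) < min k (n + 1) := fun i => by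
          have := i.2; omega
        simp only [hmin]
        have := hA ((Finset.univ.filter fun i : Fin (n + 1) => (i : ℕ) < min k (n + 1)).map
          w⁻¹.toEmbedding)
        rw [Finset.card_map, card_filter_val_lt (min_le_right _ _), Finset.sum_map] at this
        exact this)
    rw [Finset.sum_sub_distrib, ht, htot, sub_self, mul_zero] at key
    rw [e, ← sub_nonneg, ← Finset.sum_sub_distrib]
    refine key.trans_eq (Finset.sum_congr rfl fun i _ => by ring)

end Majorization

/-! ### Calculus of `valL` and the valuation of q -/

section Valuation

variable {p : ℕ} [Fact p.Prime] {K : Type*} [NormedField K] [NormedAlgebra ℚ_[p] K]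
  {L : IntermediateField ℚ_[p] K} {π : Lˣ}

theorem log_norm_prime_neg (hπ : IsPrimeElement π) : Real.log ‖((π : L) : K)‖ < 0 :=
  Real.log_neg (norm_prime_pos π) hπ.1

theorem valL_mul {x y : K} (hx : x ≠ 0) (hy : y ≠ 0) :
    valL π (x * y) = valL π x + valL π y := by
  simp only [valL, norm_mul]
  rw [Real.log_mul (norm_ne_zero_iff.2 hx) (norm_ne_zero_iff.2 hy), add_div]

theorem valL_zpow (x : K) (k : ℤ) : valL π (x ^ k) = k * valL π x := by
  simp only [valL, norm_zpow, Real.log_zpow, mul_div_assoc]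

theorem valL_pow (x : K) (k : ℕ) : valL π (x ^ k) = k * valL π x := by
  exact_mod_cast valL_zpow x k

theorem valL_prod {ι : Type*} (s : Finset ι) {f : ι → K} (hf : ∀ i ∈ s, f i ≠ 0) :
    valL π (∏ i ∈ s, f i) = ∑ i ∈ s, valL π (f i) := by
  simp only [valL, norm_prod]
  rw [Real.log_prod fun i hi => norm_ne_zero_iff.2 (hf i hi), Finset.sum_div]

theorem valL_self (hπ : IsPrimeElement π) : valL π ((π : L) : K) = 1 :=
  div_self (log_norm_prime_neg hπ).ne

theorem valL_le_valL_iff (hπ : IsPrimeElement π) {x y : K} (hx : x ≠ 0) (hy : y ≠ 0) :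
    valL π x ≤ valL π y ↔ ‖y‖ ≤ ‖x‖ := by
  rw [valL, valL, div_le_div_right_of_neg (log_norm_prime_neg hπ),
    Real.log_le_log_iff (norm_pos_iff.2 hy) (norm_pos_iff.2 hx)]

theorem norm_eq_zpow_ordL (hπ : IsPrimeElement π) (x : Lˣ) :
    ‖((x : L) : K)‖ = ‖((π : L) : K)‖ ^ ordL π x := by
  have h := coe_ordL hπ x
  rw [← norm_zpow]
  have hx : ((x : L) : K) ≠ 0 := by simp
  have hy : ((π : L) : K) ^ ordL π x ≠ 0 := zpow_ne_zero _ (by simp)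
  have e : valL π (((π : L) : K) ^ ordL π x) = valL π ((x : L) : K) := by
    rw [valL_zpow, valL_self hπ, mul_one, h]
  exact le_antisymm ((valL_le_valL_iff hπ hy hx).1 e.le) ((valL_le_valL_iff hπ hx hy).1 e.ge)

variable [IsUltrametricDist K] [FiniteDimensional ℚ_[p] L]

theorem norm_residueCard (hπ : IsPrimeElement π) :
    ‖(residueCard L : K)‖ = ‖((π : L) : K)‖ ^ Module.finrank ℚ_[p] L := by
  have hp0 : (p : L) ≠ 0 := by
    rw [← map_natCast (algebraMap ℚ_[p] L), map_ne_zero]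
    exact_mod_cast (Fact.out : p.Prime).ne_zero
  have he := norm_eq_zpow_ordL hπ (Units.mk0 (p : L) hp0)
  have hp1 : ‖(((Units.mk0 (p : L) hp0 : Lˣ) : L) : K)‖ < 1 := by
    rw [Units.val_mk0, ← map_natCast (algebraMap ℚ_[p] L)]
    change ‖algebraMap ℚ_[p] L p‖ < 1
    rw [norm_algebraMap']
    exact Padic.norm_p_lt_one
  -- This exponent is the ramification index; nonnegativity turns it into the natural number
  -- required by `norm_card_residueField`.
  have hpos : 0 ≤ ordL π (Units.mk0 (p : L) hp0) := by
    by_contra! h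
    rw [he] at hp1
    exact absurd hp1 (not_lt.2 (one_le_zpow_of_nonpos₀ (norm_prime_pos π) (le_of_lt hπ.1) h.le))
  obtain ⟨e, hee⟩ := Int.eq_ofNat_of_zero_le hpos
  rw [hee] at he
  have h : ‖(p : L)‖ = ‖(π : L)‖ ^ e := by
    rw [← zpow_natCast]; exact he
  exact norm_card_residueField (F := L) π.ne_zero hπ.1 hπ.2 h

theorem residueCard_ne_zero (hπ : IsPrimeElement π) : (residueCard L : K) ≠ 0 := by
  rw [← norm_ne_zero_iff, norm_residueCard hπ]
  exact pow_ne_zero _ (norm_prime_pos π).ne'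

theorem valL_residueCard (hπ : IsPrimeElement π) :
    valL π (residueCard L : K) = Module.finrank ℚ_[p] L := by
  rw [valL, norm_residueCard hπ, Real.log_pow, mul_div_assoc,
    div_self (log_norm_prime_neg hπ).ne, mul_one]

end Valuation

/-! ### Valuations of γ_ξ and of the coordinates -/

section Torus

variable {p : ℕ} [Fact p.Prime] {K : Type*} [NormedField K] [NormedAlgebra ℚ_[p] K]
  {L : IntermediateField ℚ_[p] K} {π : Lˣ} {n : ℕ}

theorem ordL_zpow (hπ : IsPrimeElement π) (x : Lˣ) (k : ℤ) : ordL π (x ^ k) = k * ordL π x := by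
  have := map_zpow (ordLHom hπ) x k
  have := congrArg Multiplicative.toAdd this
  rw [toAdd_zpow] at this
  simpa [ordLHom] using this

theorem ordL_self (hπ : IsPrimeElement π) : ordL π π = 1 := by
  have := coe_ordL hπ π
  rw [valL_self hπ] at this
  exact_mod_cast this

theorem ordL_weight (hπ : IsPrimeElement π) (a : Fin n → ℤ) (t : Torus L n) :
    ordL π (weight a t) = ∑ i, a i * ordL π (t i) := by
  simp only [weight, ordL_prod hπ, ordL_zpow hπ]

/-- Counting from 0, place i occurs i times as a numerator and n - 1 - i times as a denominator. -/
theorem ordL_adjointDet_eq_sum (hπ : IsPrimeElement π) (t : Torus L n) :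
    ordL π (adjointDet t) = ∑ i : Fin n, (2 * (i : ℤ) - (n - 1)) * ordL π (t i) := by
  rw [ordL_adjointDet hπ]
  have h2 : ∑ i : Fin n, ∑ j ∈ Finset.Iio i, ordL π (t j)
      = ∑ i : Fin n, ∑ j ∈ Finset.Ioi i, ordL π (t i) :=
    Finset.sum_comm' fun i j => by simp
  simp only [Finset.sum_sub_distrib, h2]
  rw [← Finset.sum_sub_distrib]
  refine Finset.sum_congr rfl fun i _ => ?_
  simp only [Finset.sum_const, Fin.card_Iio, Fin.card_Ioi, nsmul_eq_mul]
  rw [← sub_mul]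
  congr 1
  have := i.2
  omega

/-- The summand with constant coefficient n - 1 is permutation invariant and cancels, so the
remaining coefficients 2i can be halved exactly. -/
theorem ordL_adjointDet_weylAct_sub (hπ : IsPrimeElement π) (w : Equiv.Perm (Fin n))
    (t : Torus L n) :
    (ordL π (adjointDet (weylAct w t)) - ordL π (adjointDet t)) / 2
      = ∑ i : Fin n, (i : ℤ) * (ordL π (t (w⁻¹ i)) - ordL π (t i)) := by
  have h : ordL π (adjointDet (weylAct w t)) - ordL π (adjointDet t)
      = 2 * ∑ i : Fin n, (i : ℤ) * (ordL π (t (w⁻¹ i)) - ordL π (t i)) := by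
    have h3 : ∑ i, ordL π (t (w⁻¹ i)) = ∑ i, ordL π (t i) :=
      Equiv.sum_comp w⁻¹ fun i => ordL π (t i)
    rw [ordL_adjointDet_eq_sum hπ, ordL_adjointDet_eq_sum hπ]
    simp only [weylAct, sub_mul, mul_assoc, mul_sub, Finset.sum_sub_distrib, ← Finset.mul_sum, h3]
    ring
  rw [h, Int.mul_ediv_cancel_left _ two_ne_zero]

theorem isAntidominant_iff_antitone_ordL (hπ : IsPrimeElement π) (t : Torus L n) :
    IsAntidominant t ↔ Antitone fun i => ordL π (t i) := by
  rw [isAntidominant_iff]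
  refine forall₂_congr fun i j => imp_congr_right fun _ => ?_
  have h : ∀ x : Lˣ, ‖(x : L)‖ = ‖((π : L) : K)‖ ^ ordL π x := fun x => norm_eq_zpow_ordL hπ x
  simp only [h]
  exact zpow_le_zpow_iff_right_of_lt_one₀ (norm_prime_pos π) hπ.1

/-- An element of T and its diagonal of powers of π differ by units. Hence a point of the dual torus
is determined by its values on the classes λ_{i}. -/
theorem toLam_eq_prod (hπ : IsPrimeElement π) (t : Torus L n) :
    toLam L n t = ∏ i, toLam L n (Pi.mulSingle i π) ^ ordL π (t i) := by
  have e : ∏ i, toLam L n (Pi.mulSingle i π) ^ ordL π (t i)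
      = toLam L n fun i => π ^ ordL π (t i) := by
    rw [← Finset.univ_prod_mulSingle fun i => π ^ ordL π (t i), map_prod]
    refine Finset.prod_congr rfl fun i _ => ?_
    exact (map_zpow (toLam L n) _ _).symm.trans (congrArg _ (Pi.mulSingle_zpow (f := fun _ : Fin n => Lˣ) i π _).symm)
  rw [e]
  refine (QuotientGroup.eq (s := torusUnits L n)).2 fun i => ?_
  have h : ∀ x : Lˣ, ‖(x : L)‖ = ‖((π : L) : K)‖ ^ ordL π x := fun x => norm_eq_zpow_ordL hπ x
  rw [h, Pi.mul_apply, Pi.inv_apply, inv_mul_eq_div, ordL_div hπ, ordL_zpow hπ, ordL_self hπ]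
  simp

theorem valL_apply_toLam (hπ : IsPrimeElement π) (ζ : DualTorus L n) (t : Torus L n) :
    valL π ((ζ (toLam L n t) : Kˣ) : K)
      = ∑ i, valL π ((ζ (toLam L n (Pi.mulSingle i π)) : Kˣ) : K) * ordL π (t i) := by
  rw [toLam_eq_prod hπ, map_prod, Units.coe_prod, valL_prod _ fun i _ => Units.ne_zero _]
  refine Finset.sum_congr rfl fun i _ => ?_
  rw [map_zpow, Units.val_zpow_eq_zpow_val, valL_zpow, mul_comm]

variable [IsUltrametricDist K] [FiniteDimensional ℚ_[p] L]

theorem gammaXi_ne_zero (hπ : IsPrimeElement π) (a : Fin n → ℤ) (w : Equiv.Perm (Fin n))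
    (t : Torus L n) : gammaXi π a w t ≠ 0 :=
  mul_ne_zero (zpow_ne_zero _ (residueCard_ne_zero hπ)) (zpow_ne_zero _ (by simp))

/-- The modulus contributes i[L:ℚ_p] through val_L(q) and the weight contributes a_i, which together
form the prescribed type of the filtration. -/
theorem valL_gammaXi (hπ : IsPrimeElement π) (a : Fin n → ℤ) (w : Equiv.Perm (Fin n))
    (t : Torus L n) :
    valL π (gammaXi π a w t) = ∑ i : Fin n,
      ((a i + (i : ℤ) * (Module.finrank ℚ_[p] L : ℤ) : ℤ) : ℝ) *
        (ordL π (t (w⁻¹ i)) - ordL π (t i)) := by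
  rw [gammaXi, modulusHalfRatio, valL_mul (zpow_ne_zero _ (residueCard_ne_zero hπ))
    (zpow_ne_zero _ (by simp)), valL_zpow, valL_zpow, valL_self hπ, valL_residueCard hπ,
    ordL_adjointDet_weylAct_sub hπ, ordL_weight hπ, ordL_weight hπ, ← Finset.sum_sub_distrib]
  push_cast
  rw [Finset.sum_mul, mul_one, ← Finset.sum_add_distrib]
  refine Finset.sum_congr rfl fun i _ => ?_
  simp only [weylAct]
  ring

theorem coord_ne_zero (hπ : IsPrimeElement π) (a : Fin n → ℤ) (ζ : DualTorus L n) (i : Fin n) :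
    coord π a ζ i ≠ 0 :=
  mul_ne_zero (mul_ne_zero (pow_ne_zero _ (residueCard_ne_zero hπ)) (zpow_ne_zero _ (by simp)))
    (Units.ne_zero _)

theorem valL_coord (hπ : IsPrimeElement π) (a : Fin n → ℤ) (ζ : DualTorus L n) (i : Fin n) :
    valL π (coord π a ζ i) = ((a i + (i : ℤ) * (Module.finrank ℚ_[p] L : ℤ) : ℤ) : ℝ)
      + valL π ((ζ (toLam L n (Pi.mulSingle i π)) : Kˣ) : K) := by
  rw [coord, valL_mul (mul_ne_zero (pow_ne_zero _ (residueCard_ne_zero hπ))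
    (zpow_ne_zero _ (by simp))) (Units.ne_zero _), valL_mul (pow_ne_zero _ (residueCard_ne_zero hπ))
    (zpow_ne_zero _ (by simp)), valL_zpow, valL_pow, valL_self hπ, valL_residueCard hπ]
  push_cast
  ring

/-- Membership in `T'_ξ(K)` says that the Hodge polygon lies below the Newton polygon. -/
theorem mem_affinoidDomain_iff {d : ℕ} (hπ : IsPrimeElement π) {a : Fin (d + 1) → ℤ}
    (ha : Monotone a) (ζ : DualTorus L (d + 1)) {b : Fin (d + 1) → ℤ}
    (hb : ∀ i, b i = a i + (i : ℤ) * (Module.finrank ℚ_[p] L : ℤ)) :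
    ζ ∈ affinoidDomain π a ↔
      (∀ A : Finset (Fin (d + 1)), ∑ i with Fin.val i < A.card, (b i : ℝ)
        ≤ ∑ i ∈ A, valL π (coord π a ζ i)) ∧
      ∑ i, valL π (coord π a ζ i) = ∑ i, (b i : ℝ) := by
  have hbm : Monotone fun i => (b i : ℝ) := fun i j hij => by
    simp only [hb]
    have h1 : (i : ℤ) ≤ (j : ℤ) := by exact_mod_cast hij
    have := ha hij
    exact Int.cast_le.2 (add_le_add this (mul_le_mul_of_nonneg_right h1 (by positivity)))
  rw [← forall_sum_mul_le_iff hbm]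
  -- Larger norm means smaller valuation. The subtracted sum ∑ b_i m_i from γ_ξ moves to the other
  -- side, where it turns the values of ζ into coordinates.
  have key : ∀ (t : Torus L (d + 1)) (w : Equiv.Perm (Fin (d + 1))),
      ‖((ζ (toLam L (d + 1) t) : Kˣ) : K)‖ ≤ ‖gammaXi π a w t‖ ↔
      ∑ i, (b i : ℝ) * (ordL π (t (w⁻¹ i)) : ℤ)
        ≤ ∑ i, valL π (coord π a ζ i) * (ordL π (t i) : ℤ) := fun t w => by
    rw [← valL_le_valL_iff hπ (gammaXi_ne_zero hπ a w t) (Units.ne_zero _), valL_gammaXi hπ,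
      valL_apply_toLam hπ]
    simp only [valL_coord hπ, ← hb, mul_sub, add_mul, Finset.sum_sub_distrib,
      Finset.sum_add_distrib]
    exact sub_le_iff_le_add'
  constructor
  · intro h m w hm
    have hord : ∀ i, ordL π (π ^ m i) = m i := fun i => by
      rw [ordL_zpow hπ, ordL_self hπ, mul_one]
    have h1 := h fun i => π ^ m i
    rw [gammaDom_eq π a _ w ((isAntidominant_iff_antitone_ordL hπ _).2 (by
      simpa only [weylAct, hord] using hm)), key] at h1
    simpa only [hord] using h1
  · intro h t
    obtain ⟨w, hw⟩ := exists_weylAct_isAntidominant t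
    rw [gammaDom_eq π a t w hw, key]
    exact h (fun i => ordL π (t i)) w ((isAntidominant_iff_antitone_ordL hπ _).1 hw)

end Torus

/-! ### Counting lemmas for monotone integer sequences -/

section Counting

/-- The set c ≤ b i is a final segment, so its intersection with an initial segment is as small as
the cardinalities permit. The truncated subtraction supplies the value zero when the segments are
disjoint. -/
theorem Monotone.card_filter_lt_and_le {n : ℕ} {b : Fin n → ℤ} (hb : Monotone b) {k : ℕ}
    (hk : k ≤ n) (c : ℤ) :
    (Finset.univ.filter fun i : Fin n => (i : ℕ) < k ∧ c ≤ b i).card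
      = k + (Finset.univ.filter fun i => c ≤ b i).card - n := by
  set r := (Finset.univ.filter fun i => ¬ c ≤ b i).card with hr
  have hrn : (Finset.univ.filter fun i => c ≤ b i).card + r = n := by
    rw [Finset.card_filter_add_card_filter_not]; simp
  have hiff : ∀ i, c ≤ b i ↔ ¬ (i : ℕ) < r := fun i => by
    constructor
    · intro h
      have : r ≤ (Finset.Iio i).card := Finset.card_le_card fun j hj => by
        simp only [Finset.mem_filter, Finset.mem_univ, true_and, not_le] at hj
        exact Finset.mem_Iio.2 (lt_of_not_ge fun hij => absurd (hb hij) (by omega))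
      rw [Fin.card_Iio] at this
      omega
    · intro h
      by_contra h'
      have : (Finset.Iic i).card ≤ r := Finset.card_le_card fun j hj => by
        have := hb (Finset.mem_Iic.1 hj)
        simp only [Finset.mem_filter, Finset.mem_univ, true_and]
        omega
      rw [Fin.card_Iic] at this
      omega
  have h1 : (Finset.univ.filter fun i : Fin n => (i : ℕ) < k ∧ c ≤ b i).card
      + (Finset.univ.filter fun i : Fin n => (i : ℕ) < min k r).card
      = (Finset.univ.filter fun i : Fin n => (i : ℕ) < k).card := by
    rw [← Finset.card_filter_add_card_filter_not
      (s := Finset.univ.filter fun i : Fin n => (i : ℕ) < k) (fun i => c ≤ b i),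
      Finset.filter_filter, Finset.filter_filter]
    simp only [hiff, not_not, lt_min_iff]
  rw [card_filter_val_lt hk, card_filter_val_lt (min_le_of_left_le hk)] at h1
  omega

/-- Layer-cake formula: b i - lo counts the levels lo + 1, …, lo + M that b i reaches. -/
theorem sum_eq_mul_card_add_sum_card_filter {ι : Type*} (J : Finset ι) (b : ι → ℤ) (lo : ℤ)
    (M : ℕ) (hlo : ∀ i ∈ J, lo ≤ b i) (hM : ∀ i ∈ J, b i ≤ lo + M) :
    ∑ i ∈ J, b i = lo * J.card +
      ∑ k ∈ Finset.range M, ((J.filter fun i => lo + (k + 1) ≤ b i).card : ℤ) := by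
  simp only [Finset.card_filter, Nat.cast_sum]
  rw [Finset.sum_comm, mul_comm, ← nsmul_eq_mul, ← Finset.sum_const, ← Finset.sum_add_distrib]
  refine Finset.sum_congr rfl fun i hi => ?_
  have h1 := hlo i hi
  have h2 := hM i hi
  have : ∑ k ∈ Finset.range M, ((if lo + ((k : ℤ) + 1) ≤ b i then 1 else 0 : ℕ) : ℤ)
      = ((Finset.range (b i - lo).toNat).card : ℤ) := by
    rw [← Nat.cast_sum, ← Finset.card_filter]
    congr 2
    ext k
    simp only [Finset.mem_filter, Finset.mem_range]
    omega
  rw [this, Finset.card_range]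
  omega

end Counting

/-! ### Hodge numbers from the dimensions of filtration steps -/

namespace BanachHecke.FilteredIsocrystal

variable {K V : Type*} [Field K] [AddCommGroup V] [Module K V] [FiniteDimensional K V]

theorem grDim_add_finrank (D : FilteredIsocrystal K V) (c : ℤ) :
    D.grDim c + finrank K (D.fil (c + 1)) = finrank K (D.fil c) := by
  rw [grDim, ← Submodule.finrank_quotient_add_finrank
    ((D.fil (c + 1)).comap (D.fil c).subtype)]
  congr 1
  exact (LinearEquiv.finrank_eq (Submodule.comapSubtypeEquivOfLe
    (D.antitone_fil (by omega : c ≤ c + 1)))).symm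

/-- A finite basis is exhausted at a common step. At the other end the descending chain stabilizes,
and its stable value lies in every step, hence vanishes by separatedness. -/
theorem exists_fil_eq_top_bot (D : FilteredIsocrystal K V) :
    ∃ (lo : ℤ) (M : ℕ), D.fil lo = ⊤ ∧ D.fil (lo + M) = ⊥ := by
  have hlo : ∃ lo, D.fil lo = ⊤ := by
    let B := finBasis K V
    choose f hf using fun i => D.exhaustive (B i)
    obtain ⟨lo, hlo⟩ := (Set.finite_range f).bddBelow
    refine ⟨lo, top_unique ?_⟩
    rw [← B.span_eq, Submodule.span_le]
    rintro _ ⟨i, rfl⟩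
    exact D.antitone_fil (hlo ⟨i, rfl⟩) (hf i)
  obtain ⟨lo, hlo⟩ := hlo
  obtain ⟨M, hM⟩ := IsArtinian.monotone_stabilizes
    (⟨fun k : ℕ => OrderDual.toDual (D.fil (lo + k)),
      fun i j hij => D.antitone_fil (by omega)⟩ : ℕ →o (Submodule K V)ᵒᵈ)
  refine ⟨lo, M, hlo, (Submodule.eq_bot_iff _).2 fun x hx => D.separated x fun i => ?_⟩
  have h := hM (max M (i - lo).toNat) (le_max_left _ _)
  have h' : D.fil (lo + M) = D.fil (lo + (max M (i - lo).toNat : ℕ)) := h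
  rw [h'] at hx
  exact D.antitone_fil (by omega) hx

/-- Summation by parts. Dimensions of filtration steps, unlike graded pieces, can be compared
directly with intersections. -/
theorem tH_eq (D : FilteredIsocrystal K V) {lo : ℤ} {M : ℕ} (hlo : D.fil lo = ⊤)
    (hM : D.fil (lo + M) = ⊥) :
    D.tH = lo * finrank K V
      + ∑ k ∈ Finset.range M, (finrank K (D.fil (lo + (k + 1))) : ℤ) := by
  have hgr : ∀ c, (D.grDim c : ℤ) = finrank K (D.fil c) - finrank K (D.fil (c + 1)) :=
    fun c => by have := D.grDim_add_finrank c; omega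
  have hsupp : (Function.support fun c : ℤ => c * (D.grDim c : ℤ)) ⊆
      ((Finset.range M).image fun k : ℕ => lo + (k : ℤ) : Finset ℤ) := by
    intro c hc
    have hc' : D.grDim c ≠ 0 := fun h => hc (by simp [h])
    simp only [Finset.coe_image, Set.mem_image, Finset.mem_coe, Finset.mem_range]
    have h1 : lo ≤ c := by
      by_contra! h
      have e1 : D.fil c = ⊤ := top_unique (hlo ▸ D.antitone_fil h.le)
      have e2 : D.fil (c + 1) = ⊤ := top_unique (hlo ▸ D.antitone_fil (by omega))
      have := hgr c
      rw [e1, e2] at this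
      omega
    have h2 : c < lo + M := by
      by_contra! h
      have e1 : D.fil c = ⊥ := bot_unique (hM ▸ D.antitone_fil h)
      have := D.grDim_add_finrank c
      rw [e1, finrank_bot] at this
      omega
    exact ⟨(c - lo).toNat, by omega, by omega⟩
  rw [tH, finsum_eq_sum_of_support_subset _ hsupp, Finset.sum_image fun i _ j _ h => by simpa using h]
  have key : ∀ m : ℕ, ∑ k ∈ Finset.range m, (lo + k) * (D.grDim (lo + k) : ℤ)
      = lo * finrank K V + ∑ k ∈ Finset.range m, (finrank K (D.fil (lo + (k + 1))) : ℤ)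
        - (lo + m) * finrank K (D.fil (lo + m)) := fun m => by
    induction m with
    | zero =>
      have e : D.fil (lo + (0 : ℕ)) = ⊤ := by rw [Nat.cast_zero, add_zero, hlo]
      rw [e, finrank_top]
      simp
    | succ m ih =>
      rw [Finset.sum_range_succ, Finset.sum_range_succ, ih, hgr, add_assoc lo (m : ℤ) 1]
      push_cast
      ring
  refine (key M).trans ?_
  rw [hM, finrank_bot]
  simp

theorem HasType.finrank_fil {n : ℕ} {D : FilteredIsocrystal K V} {b : Fin n → ℤ}
    (h : D.HasType b) (c : ℤ) :
    finrank K (D.fil c) = (Finset.univ.filter fun i => c ≤ b i).card := by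
  obtain ⟨lo, M, -, hM⟩ := D.exists_fil_eq_top_bot
  have hbot : ∀ c, lo + M ≤ c → D.fil c = ⊥ := fun c hc =>
    bot_unique (hM ▸ D.antitone_fil hc)
  have hlt : ∀ i, b i < lo + M := fun i => by
    by_contra! hi
    have h1 := h.2 (b i)
    have h2 := D.grDim_add_finrank (b i)
    rw [hbot _ hi, finrank_bot] at h2
    have h3 : 0 < (Finset.univ.filter fun j => b j = b i).card :=
      Finset.card_pos.2 ⟨i, by simp⟩
    omega
  rcases le_total (lo + M) c with hc | hc
  · rw [hbot _ hc, finrank_bot, eq_comm, Finset.card_eq_zero]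
    exact Finset.filter_false_of_mem fun i _ => by have := hlt i; omega
  · induction c, hc using Int.leInductionDown with
    | base =>
      rw [hM, finrank_bot, eq_comm, Finset.card_eq_zero]
      exact Finset.filter_false_of_mem fun i _ => by have := hlt i; omega
    | pred c _ ih =>
      rw [← D.grDim_add_finrank, h.2, sub_add_cancel, ih,
        ← Finset.card_union_of_disjoint (Finset.disjoint_filter.2 fun i _ h1 h2 => by omega),
        ← Finset.filter_or]
      congr 1
      ext i
      simp only [Finset.mem_filter, Finset.mem_univ, true_and]
      omega

theorem finrank_restrict_fil (D : FilteredIsocrystal K V) (W : Submodule K V)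
    (hW : ∀ x ∈ W, D.frob x ∈ W) (c : ℤ) :
    finrank K ((D.restrict W hW).fil c) = finrank K ↥(W ⊓ D.fil c) := by
  rw [← Submodule.map_comap_subtype, Submodule.finrank_map_subtype_eq]
  rfl

section Bounds

variable {n : ℕ} {D : FilteredIsocrystal K V} {b : Fin n → ℤ}

theorem HasType.exists_bounds (h : D.HasType b) (hn : finrank K V = n) :
    ∃ (lo : ℤ) (M : ℕ), (∀ i, lo ≤ b i) ∧ (∀ i, b i ≤ lo + M) ∧
      D.fil lo = ⊤ ∧ D.fil (lo + M) = ⊥ := by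
  obtain ⟨lo, M, hlo, hM⟩ := D.exists_fil_eq_top_bot
  refine ⟨lo, M, fun i => ?_, fun i => ?_, hlo, hM⟩
  · have h1 := h.finrank_fil lo
    rw [hlo, finrank_top, hn, eq_comm] at h1
    have h2 := (Finset.card_filter_eq_iff (s := Finset.univ) (p := fun i => lo ≤ b i)).1
      (by simpa using h1)
    exact h2 i (Finset.mem_univ i)
  · have h1 := h.finrank_fil (lo + M)
    rw [hM, finrank_bot, eq_comm, Finset.card_eq_zero, Finset.filter_eq_empty_iff] at h1
    exact (not_le.1 (h1 (Finset.mem_univ i))).le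

/-- The Hodge number of an invariant subspace, compared with that of a generic subspace of the
same dimension. -/
theorem HasType.tH_restrict (h : D.HasType b) (hn : finrank K V = n) (W : Submodule K V)
    (hW : ∀ x ∈ W, D.frob x ∈ W) :
    ∃ (lo : ℤ) (M : ℕ), (D.restrict W hW).tH = ∑ i with Fin.val i < finrank K W, b i
      + ∑ k ∈ Finset.range M, ((finrank K ↥(W ⊓ D.fil (lo + (k + 1))) : ℤ)
        - (finrank K W + finrank K (D.fil (lo + (k + 1))) - n : ℕ)) := by
  obtain ⟨lo, M, hb1, hb2, hlo, hM⟩ := h.exists_bounds hn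
  have hWn : finrank K W ≤ n := hn ▸ Submodule.finrank_le W
  refine ⟨lo, M, ?_⟩
  rw [tH_eq (lo := lo) (M := M) (D.restrict W hW)
    (by change (D.fil lo).comap W.subtype = ⊤; rw [hlo, Submodule.comap_top])
    (by change (D.fil (lo + M)).comap W.subtype = ⊥; rw [hM, Submodule.comap_bot, Submodule.ker_subtype]),
    sum_eq_mul_card_add_sum_card_filter _ b lo M (fun i _ => hb1 i) (fun i _ => hb2 i),
    card_filter_val_lt hWn, add_assoc, ← Finset.sum_add_distrib]
  congr 1
  refine Finset.sum_congr rfl fun k _ => ?_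
  -- Both t_H and the sum of the smallest b_i are now layer sums; the latter has the generic
  -- intersection dimension in each layer.
  rw [finrank_restrict_fil, Finset.filter_filter, h.1.card_filter_lt_and_le hWn, h.finrank_fil]
  ring

/-- Each intersection with a filtration step has at least its generic dimension, by the dimension
formula for a sum of subspaces. -/
theorem HasType.sum_le_tH_restrict (h : D.HasType b) (hn : finrank K V = n) (W : Submodule K V)
    (hW : ∀ x ∈ W, D.frob x ∈ W) :
    ∑ i with Fin.val i < finrank K W, b i ≤ (D.restrict W hW).tH := by
  obtain ⟨lo, M, e⟩ := h.tH_restrict hn W hW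
  rw [e]
  refine le_add_of_nonneg_right (Finset.sum_nonneg fun k _ => ?_)
  have h1 := Submodule.finrank_sup_add_finrank_inf_eq W (D.fil (lo + (k + 1)))
  have h2 := hn ▸ Submodule.finrank_le (W ⊔ D.fil (lo + (k + 1)))
  omega

theorem HasType.tH_restrict_le_sum (h : D.HasType b) (hn : finrank K V = n) (W : Submodule K V)
    (hW : ∀ x ∈ W, D.frob x ∈ W)
    (hgen : ∀ c, finrank K ↥(W ⊓ D.fil c) ≤ finrank K W + finrank K (D.fil c) - n) :
    (D.restrict W hW).tH ≤ ∑ i with Fin.val i < finrank K W, b i := by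
  obtain ⟨lo, M, e⟩ := h.tH_restrict hn W hW
  rw [e]
  refine add_le_of_nonpos_right (Finset.sum_nonpos fun k _ => ?_)
  have h1 := hgen (lo + (k + 1))
  omega

theorem HasType.tH_eq_sum (h : D.HasType b) (hn : finrank K V = n) : D.tH = ∑ i, b i := by
  obtain ⟨lo, M, hb1, hb2, hlo, hM⟩ := h.exists_bounds hn
  rw [D.tH_eq hlo hM, sum_eq_mul_card_add_sum_card_filter _ b lo M (fun i _ => hb1 i)
    (fun i _ => hb2 i), Finset.card_univ, Fintype.card_fin, hn]
  simp only [h.finrank_fil]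

end Bounds

end BanachHecke.FilteredIsocrystal

/-! ### Determinants on invariant subspaces -/

section InvariantSubspaces

variable {K V : Type*} [Field K] [AddCommGroup V] [Module K V] [FiniteDimensional K V]

theorem LinearMap.det_restrict_of_eq_top (f : End K V) {W : Submodule K V}
    (hW : ∀ x ∈ W, f x ∈ W) (h : W = ⊤) : LinearMap.det (f.restrict hW) = LinearMap.det f := by
  have : Subsingleton (V ⧸ W) := Submodule.Quotient.subsingleton_iff.2 h
  rw [f.det_eq_det_mul_det W hW, LinearMap.det_eq_one_of_subsingleton (W.mapQ W f hW), mul_one]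

/-- The effect on dimension and determinant of enlarging an invariant subspace by one vector which
is an eigenvector modulo the subspace. -/
theorem LinearMap.det_restrict_of_le_sup_span_singleton (f : End K V) {W W' : Submodule K V}
    (hW : ∀ x ∈ W, f x ∈ W) (hW' : ∀ x ∈ W', f x ∈ W') (hle : W ≤ W') {x : V} (hx' : x ∈ W')
    (hx : x ∉ W) (hsup : W' ≤ W ⊔ Submodule.span K {x}) {μ : K} (hμ : f x - μ • x ∈ W) :
    finrank K W' = finrank K W + 1 ∧
      LinearMap.det (f.restrict hW') = LinearMap.det (f.restrict hW) * μ := by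
  set U : Submodule K W' := W.comap W'.subtype with hU
  let E : U ≃ₗ[K] W := Submodule.comapSubtypeEquivOfLe hle
  have hspan : ∀ y : W', ∃ c : K, y - c • (⟨x, hx'⟩ : W') ∈ U := fun y => by
    obtain ⟨w, hw, z, hz, e⟩ := Submodule.mem_sup.1 (hsup y.2)
    obtain ⟨c, rfl⟩ := Submodule.mem_span_singleton.1 hz
    refine ⟨c, ?_⟩
    change (y : V) - c • x ∈ W
    rw [← e, add_sub_cancel_right]
    exact hw
  -- The quotient is a line on which f acts by μ, and the determinant is multiplicative along it.
  have hone : finrank K (W' ⧸ U) = 1 := by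
    refine finrank_eq_one (U.mkQ ⟨x, hx'⟩) ?_ fun q => ?_
    · rw [Ne, Submodule.mkQ_apply, Submodule.Quotient.mk_eq_zero]
      exact hx
    · obtain ⟨y, rfl⟩ := U.mkQ_surjective q
      obtain ⟨c, hc⟩ := hspan y
      refine ⟨c, ?_⟩
      rw [← map_smul, eq_comm, ← sub_eq_zero, ← map_sub, Submodule.mkQ_apply,
        Submodule.Quotient.mk_eq_zero]
      exact hc
  refine ⟨?_, ?_⟩
  · rw [← Submodule.finrank_quotient_add_finrank U, hone, E.finrank_eq, add_comm]
  · have hUinv : U ≤ U.comap (f.restrict hW') := fun y hy => hW _ hy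
    rw [LinearMap.det_eq_det_mul_det U (f.restrict hW') hUinv]
    congr 1
    · rw [← LinearMap.det_conj _ E]
      congr 1
    · have : U.mapQ U (f.restrict hW') hUinv = μ • LinearMap.id := by
        refine LinearMap.ext fun q => ?_
        obtain ⟨y, rfl⟩ := U.mkQ_surjective q
        obtain ⟨c, hc⟩ := hspan y
        rw [LinearMap.smul_apply, LinearMap.id_apply, Submodule.mkQ_apply, Submodule.mapQ_apply,
          ← Submodule.Quotient.mk_smul, Submodule.Quotient.eq]
        change f y - μ • (y : V) ∈ W
        have h1 : (y : V) - c • x ∈ W := hc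
        have h2 : f y - μ • (y : V) = f ((y : V) - c • x) - μ • ((y : V) - c • x)
            + c • (f x - μ • x) := by
          rw [map_sub, map_smul]; module
        rw [h2]
        exact W.add_mem (W.sub_mem (hW _ h1) (W.smul_mem _ h1)) (W.smul_mem _ hμ)
      rw [this, LinearMap.det_smul, hone, LinearMap.det_id]
      simp

variable {ι : Type*} [Fintype ι] [DecidableEq ι]

/-- If the semisimple part of `f` is diagonal with eigenvalues `ζ i`, then any subfamily of the
`ζ i` is realized by an `f`-invariant subspace. -/
theorem exists_invariant_det_restrict_eq_prod {f s : End K V} (hcomm : Commute s (f - s))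
    (hnil : IsNilpotent (f - s)) {v : ι → V} (hv : LinearIndependent K v) {ζ : ι → K}
    (hs : ∀ i, s (v i) = ζ i • v i) (A : Finset ι) :
    ∃ (W : Submodule K V) (hW : ∀ x ∈ W, f x ∈ W),
      finrank K W = A.card ∧ LinearMap.det (f.restrict hW) = ∏ i ∈ A, ζ i := by
  classical
  -- Adjoin one eigenvalue at a time. The stronger hypothesis, stability under s and a bound on the
  -- intersection with each eigenspace, leaves an eigenvector outside W for every unused index.
  suffices h : ∃ (W : Submodule K V) (hW : ∀ x ∈ W, f x ∈ W), (∀ x ∈ W, s x ∈ W) ∧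
      (∀ μ, finrank K ↥(W ⊓ s.eigenspace μ) ≤ (A.filter fun i => ζ i = μ).card) ∧
      finrank K W = A.card ∧ LinearMap.det (f.restrict hW) = ∏ i ∈ A, ζ i by
    obtain ⟨W, hW, -, -, h⟩ := h
    exact ⟨W, hW, h⟩
  induction A using Finset.induction_on with
  | empty =>
    refine ⟨⊥, by simp, by simp, by simp, by simp, ?_⟩
    rw [LinearMap.det_eq_one_of_subsingleton, Finset.prod_empty]
  | insert i A hi ih =>
    obtain ⟨W, hf, hsW, hE, hfin, hdet⟩ := ih
    set μ := ζ i
    have hcard : (Finset.univ.filter fun j => ζ j = μ).card ≤ finrank K (s.eigenspace μ) := by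
      have hli : LinearIndependent K fun j : {j // ζ j = μ} =>
          (⟨v j, Module.End.mem_eigenspace_iff.2 (by rw [hs, j.2])⟩ : s.eigenspace μ) :=
        LinearIndependent.of_comp (s.eigenspace μ).subtype
          (hv.comp (fun j : {j // ζ j = μ} => (j : ι)) Subtype.val_injective)
      rw [← Fintype.card_subtype]
      exact hli.fintype_card_le_finrank
    have hnot : ¬ s.eigenspace μ ≤ W := fun hle => by
      have h1 := hE μ
      rw [inf_eq_right.2 hle] at h1
      have h2 : (A.filter fun j => ζ j = μ).card < (Finset.univ.filter fun j => ζ j = μ).card :=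
        Finset.card_lt_card (Finset.ssubset_iff_of_subset (Finset.filter_subset_filter _
          (Finset.subset_univ A)) |>.2 ⟨i, by simp [μ], by simp [hi]⟩)
      omega
    obtain ⟨y, hyE, hyW⟩ := SetLike.not_le_iff_exists.1 hnot
    have hpow : ∀ k, ((f - s) ^ k) y ∈ s.eigenspace μ := fun k => by
      rw [Module.End.mem_eigenspace_iff] at hyE ⊢
      have := congrArg (fun g : End K V => g y) (hcomm.pow_right k).eq
      simp only [Module.End.mul_apply] at this
      rw [this, hyE, map_smul]
    have hex : ∃ k, ((f - s) ^ k) y ∈ W := by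
      obtain ⟨k, hk⟩ := hnil
      exact ⟨k, by rw [hk]; exact W.zero_mem⟩
    -- Take the last iterate of y under the nilpotent part that is outside W. It stays in the
    -- eigenspace, and modulo W it is an eigenvector of f itself.
    obtain ⟨x, hxE, hxW, hνx⟩ : ∃ x, x ∈ s.eigenspace μ ∧ x ∉ W ∧ (f - s) x ∈ W := by
      have h0 : Nat.find hex ≠ 0 := fun h => hyW (by
        have := Nat.find_spec hex
        rwa [h, pow_zero] at this)
      obtain ⟨k, hk⟩ := Nat.exists_eq_succ_of_ne_zero h0
      refine ⟨_, hpow k, Nat.find_min hex (by omega), ?_⟩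
      have := Nat.find_spec hex
      rwa [hk, Nat.succ_eq_add_one, pow_succ', Module.End.mul_apply] at this
    have hsx : s x = μ • x := Module.End.mem_eigenspace_iff.1 hxE
    have hfx : f x - μ • x ∈ W := by rw [← hsx]; exact hνx
    set W' := W ⊔ Submodule.span K {x} with hW'
    have hxW' : x ∈ W' := Submodule.mem_sup_right (Submodule.mem_span_singleton_self x)
    have hinv : ∀ g : End K V, (∀ y ∈ W, g y ∈ W) → g x - μ • x ∈ W → ∀ y ∈ W', g y ∈ W' := by
      intro g hg hgx y hy
      obtain ⟨w, hw, z, hz, rfl⟩ := Submodule.mem_sup.1 hy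
      obtain ⟨c, rfl⟩ := Submodule.mem_span_singleton.1 hz
      rw [map_add, map_smul, ← sub_add_cancel (g x) (μ • x)]
      exact W'.add_mem (Submodule.mem_sup_left (hg w hw)) (W'.smul_mem _
        (W'.add_mem (Submodule.mem_sup_left hgx) (W'.smul_mem _ hxW')))
    have hf' := hinv f hf hfx
    have hs' := hinv s hsW (by rw [hsx, sub_self]; exact W.zero_mem)
    obtain ⟨h1, h2⟩ := f.det_restrict_of_le_sup_span_singleton hf hf' le_sup_left hxW' hxW le_rfl hfx
    refine ⟨W', hf', hs', fun μ' => ?_, ?_, ?_⟩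
    · by_cases hμ : μ' = μ
      · subst hμ
        have hle : W' ⊓ s.eigenspace μ ≤ (W ⊓ s.eigenspace μ) ⊔ Submodule.span K {x} := by
          rintro y ⟨hy, hyE⟩
          obtain ⟨w, hw, z, hz, rfl⟩ := Submodule.mem_sup.1 hy
          refine Submodule.add_mem_sup ⟨hw, ?_⟩ hz
          have hz' : z ∈ s.eigenspace μ :=
            (Submodule.span_singleton_le_iff_mem x _).2 hxE hz
          simpa using (s.eigenspace μ).sub_mem hyE hz'
        have h3 := Submodule.finrank_mono hle
        have h4 := Submodule.finrank_add_le_finrank_add_finrank (W ⊓ s.eigenspace μ)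
          (Submodule.span K {x})
        have h5 := finrank_span_le_card (R := K) ({x} : Set V)
        have h6 := hE μ
        rw [Finset.filter_insert, if_pos rfl, Finset.card_insert_of_notMem (by simp [hi])]
        simp at h5
        omega
      · have hle : W' ⊓ s.eigenspace μ' ≤ W ⊓ s.eigenspace μ' := by
          rintro y ⟨hy, hyE⟩
          refine ⟨?_, hyE⟩
          obtain ⟨w, hw, z, hz, rfl⟩ := Submodule.mem_sup.1 hy
          obtain ⟨c, rfl⟩ := Submodule.mem_span_singleton.1 hz
          have h3 : s (w + c • x) = μ' • (w + c • x) := Module.End.mem_eigenspace_iff.1 hyE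
          rw [map_add, map_smul, hsx] at h3
          -- For a different eigenvalue, this relation would place x in W unless c = 0, so the new
          -- line adds nothing to that eigenspace.
          have h4 : (c * (μ' - μ)) • x = s w - μ' • w := by
            rw [← sub_eq_zero] at h3
            rw [eq_comm, ← sub_eq_zero, ← h3]
            module
          have h5 : (c * (μ' - μ)) • x ∈ W := by
            rw [h4]; exact W.sub_mem (hsW w hw) (W.smul_mem _ hw)
          have h6 : c * (μ' - μ) = 0 := by
            by_contra h; exact hxW ((W.smul_mem_iff h).1 h5)
          have h7 : c = 0 := (mul_eq_zero.1 h6).resolve_right (sub_ne_zero.2 hμ)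
          simpa [h7] using hw
        rw [Finset.filter_insert, if_neg (fun h => hμ h.symm)]
        exact (Submodule.finrank_mono hle).trans (hE μ')
    · rw [h1, hfin, Finset.card_insert_of_notMem hi]
    · rw [h2, hdet, Finset.prod_insert hi, mul_comm]

end InvariantSubspaces

/-! ### The bidiagonal endomorphism and its transverse flag -/

section Bidiagonal

variable (K : Type*) [Field K] {n : ℕ}

/-- The vectors supported on the places `≥ j`. -/
def tailSubspace (n j : ℕ) : Submodule K (Fin n → K) where
  carrier := {x | ∀ i : Fin n, (i : ℕ) < j → x i = 0}
  add_mem' hx hy i hi := by simp [hx i hi, hy i hi]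
  zero_mem' _ _ := rfl
  smul_mem' c x hx i hi := by simp [hx i hi]

/-- The vectors supported on the places `< j`. -/
def headSubspace (n j : ℕ) : Submodule K (Fin n → K) where
  carrier := {x | ∀ i : Fin n, j ≤ (i : ℕ) → x i = 0}
  add_mem' hx hy i hi := by simp [hx i hi, hy i hi]
  zero_mem' _ _ := rfl
  smul_mem' c x hx i hi := by simp [hx i hi]

theorem finrank_headSubspace {j : ℕ} (hj : j ≤ n) : finrank K (headSubspace K n j) = j := by
  have e : headSubspace K n j ≃ₗ[K] (Fin j → K) :=
    LinearEquiv.ofBijective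
      ((LinearMap.funLeft K K (Fin.castLE hj)).comp (headSubspace K n j).subtype) (by
        constructor
        · rw [← LinearMap.ker_eq_bot, LinearMap.ker_eq_bot']
          intro x hx
          refine Subtype.ext (funext fun i => ?_)
          by_cases hi : (i : ℕ) < j
          · exact congrFun hx ⟨i, hi⟩
          · exact x.2 i (not_lt.1 hi)
        · intro y
          refine ⟨⟨fun i => if h : (i : ℕ) < j then y ⟨i, h⟩ else 0, fun i hi => ?_⟩, ?_⟩
          · exact dif_neg (not_lt.2 hi)
          · ext i
            simp [LinearMap.funLeft])
  rw [e.finrank_eq, finrank_fin_fun]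

variable {K}

/-- The endomorphism with matrix `diag(ζ)` plus the lower shift: `e_i ↦ ζ_i e_i + e_{i+1}`. -/
def bidiagonal (ζ : Fin n → K) : End K (Fin n → K) where
  toFun x i := ζ i * x i + if h : 0 < (i : ℕ) then x ⟨i - 1, by omega⟩ else 0
  map_add' x y := by
    funext i
    by_cases h : 0 < (i : ℕ) <;> simp only [h, Pi.add_apply, dif_pos, dite_false] <;> ring
  map_smul' c x := by
    funext i
    by_cases h : 0 < (i : ℕ) <;>
      simp only [h, Pi.smul_apply, smul_eq_mul, dif_pos, dite_false, RingHom.id_apply] <;> ring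

theorem bidiagonal_apply_of_mem_tailSubspace (ζ : Fin n → K) (i : Fin n) {x : Fin n → K}
    (hx : x ∈ tailSubspace K n i) : bidiagonal ζ x i = ζ i * x i := by
  change ζ i * x i + _ = _
  by_cases h : 0 < (i : ℕ)
  · rw [dif_pos h, hx ⟨i - 1, by omega⟩ (by simp; omega), add_zero]
  · rw [dif_neg h, add_zero]

theorem tailSubspace_anti {j k : ℕ} (h : j ≤ k) : tailSubspace K n k ≤ tailSubspace K n j :=
  fun _ hx i hi => hx i (lt_of_lt_of_le hi h)

theorem bidiagonal_mem_tailSubspace (ζ : Fin n → K) (j : ℕ) {x : Fin n → K}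
    (hx : x ∈ tailSubspace K n j) : bidiagonal ζ x ∈ tailSubspace K n j := fun i hi => by
  rw [bidiagonal_apply_of_mem_tailSubspace ζ i (tailSubspace_anti hi.le hx), hx i hi, mul_zero]

theorem mem_tailSubspace_succ_iff {i : Fin n} {x : Fin n → K} :
    x ∈ tailSubspace K n (i + 1) ↔ x ∈ tailSubspace K n i ∧ x i = 0 := by
  constructor
  · exact fun h => ⟨tailSubspace_anti (by omega) h, h i (by omega)⟩
  · rintro ⟨h1, h2⟩ j hj
    rcases Nat.lt_succ_iff_lt_or_eq.1 hj with h | h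
    · exact h1 j h
    · rwa [Fin.ext h]

theorem bidiagonal_injective {ζ : Fin n → K} (hζ : ∀ i, ζ i ≠ 0) :
    Function.Injective (bidiagonal ζ) := by
  rw [← LinearMap.ker_eq_bot, LinearMap.ker_eq_bot']
  intro x hx
  have h : ∀ j : ℕ, x ∈ tailSubspace K n j := fun j => by
    induction j with
    | zero => exact fun i hi => absurd hi (Nat.not_lt_zero _)
    | succ j ih =>
      by_cases hj : j < n
      · refine (mem_tailSubspace_succ_iff (i := ⟨j, hj⟩)).2 ⟨ih, ?_⟩
        have := bidiagonal_apply_of_mem_tailSubspace ζ ⟨j, hj⟩ ih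
        rw [hx] at this
        exact (mul_eq_zero.1 this.symm).resolve_left (hζ _)
      · exact fun i _ => ih i (by omega)
  exact funext fun i => h n i i.2

/-- Intersect W with the stable tail flag: each successive quotient is zero or a line on which the
map acts by ζ j. The set A records the jumps. -/
theorem exists_det_restrict_bidiagonal_eq_prod (ζ : Fin n → K) {W : Submodule K (Fin n → K)}
    (hW : ∀ x ∈ W, bidiagonal ζ x ∈ W) :
    ∃ A : Finset (Fin n), A.card = finrank K W ∧
      LinearMap.det ((bidiagonal ζ).restrict hW) = ∏ i ∈ A, ζ i := by
  suffices h : ∀ k j : ℕ, j + k = n → ∀ (W : Submodule K (Fin n → K))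
      (hW : ∀ x ∈ W, bidiagonal ζ x ∈ W), W ≤ tailSubspace K n j →
      ∃ A : Finset (Fin n), (∀ i ∈ A, j ≤ (i : ℕ)) ∧ A.card = finrank K W ∧
        LinearMap.det ((bidiagonal ζ).restrict hW) = ∏ i ∈ A, ζ i by
    obtain ⟨A, -, h⟩ := h n 0 (zero_add n) W hW fun x _ i hi => absurd hi (Nat.not_lt_zero _)
    exact ⟨A, h⟩
  intro k
  induction k with
  | zero =>
    intro j hj W hW hle
    have hbot : W = ⊥ := (Submodule.eq_bot_iff _).2 fun x hx =>
      funext fun i => hle hx i (by omega)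
    have : Subsingleton W := by rw [hbot]; infer_instance
    refine ⟨∅, by simp, by
      rw [Finset.card_empty, finrank_zero_of_subsingleton], ?_⟩
    rw [LinearMap.det_eq_one_of_subsingleton, Finset.prod_empty]
  | succ k ih =>
    intro j hj W hW hle
    let i : Fin n := ⟨j, by omega⟩
    by_cases hall : ∀ x ∈ W, x i = 0
    · obtain ⟨A, h1, h2⟩ := ih (j + 1) (by omega) W hW fun x hx =>
        (mem_tailSubspace_succ_iff (i := i)).2 ⟨hle hx, hall x hx⟩
      exact ⟨A, fun i' hi' => (Nat.le_succ j).trans (h1 i' hi'), h2⟩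
    · push Not at hall
      obtain ⟨x, hxW, hxi⟩ := hall
      have hW1 : ∀ y ∈ W ⊓ tailSubspace K n (j + 1),
          bidiagonal ζ y ∈ W ⊓ tailSubspace K n (j + 1) :=
        fun y hy => ⟨hW y hy.1, bidiagonal_mem_tailSubspace ζ _ hy.2⟩
      obtain ⟨A, h1, h2, h3⟩ := ih (j + 1) (by omega) _ hW1 inf_le_right
      have hmem : ∀ y ∈ W, y i = 0 → y ∈ W ⊓ tailSubspace K n (j + 1) := fun y hy h0 =>
        ⟨hy, (mem_tailSubspace_succ_iff (i := i)).2 ⟨hle hy, h0⟩⟩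
      have hstep := (bidiagonal ζ).det_restrict_of_le_sup_span_singleton hW1 hW inf_le_left hxW
        (fun h => hxi (h.2 i (Nat.lt_succ_self j))) (fun y hy => by
          rw [← sub_add_cancel y ((y i / x i) • x)]
          refine Submodule.add_mem_sup (hmem _ (W.sub_mem hy (W.smul_mem _ hxW)) ?_)
            (Submodule.smul_mem _ _ (Submodule.mem_span_singleton_self x))
          simp [div_mul_cancel₀ _ hxi]) (μ := ζ i)
        (hmem _ (W.sub_mem (hW x hxW) (W.smul_mem _ hxW)) (by
          rw [Pi.sub_apply, bidiagonal_apply_of_mem_tailSubspace ζ i (hle hxW)]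
          simp))
      have hiA : i ∉ A := fun h => by have := h1 i h; simp [i] at this
      refine ⟨insert i A, fun i' hi' => ?_, ?_, ?_⟩
      · rcases Finset.mem_insert.1 hi' with rfl | h
        · exact le_rfl
        · exact (Nat.le_succ j).trans (h1 i' h)
      · rw [Finset.card_insert_of_notMem hiA, h2, hstep.1]
      · rw [hstep.2, h3, Finset.prod_insert hiA, mul_comm]

theorem det_bidiagonal (ζ : Fin n → K) : LinearMap.det (bidiagonal ζ) = ∏ i, ζ i := by
  obtain ⟨A, h1, h2⟩ := exists_det_restrict_bidiagonal_eq_prod ζ (W := ⊤)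
    fun _ _ => Submodule.mem_top
  rw [LinearMap.det_restrict_of_eq_top _ _ rfl] at h2
  rw [finrank_top, finrank_fin_fun] at h1
  rw [h2, (Finset.card_eq_iff_eq_univ A).1 (by simpa using h1)]

/-- The flag of the spaces `headSubspace K n j` is in general position with respect to every
invariant subspace. -/
theorem finrank_inf_headSubspace_le (ζ : Fin n → K) {W : Submodule K (Fin n → K)}
    (hW : ∀ x ∈ W, bidiagonal ζ x ∈ W) {j : ℕ} (hj : j ≤ n) :
    finrank K ↥(W ⊓ headSubspace K n j) ≤ finrank K W + j - n := by
  induction hj using Nat.decreasingInduction with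
  | self => simpa using Submodule.finrank_mono (inf_le_left (a := W) (b := headSubspace K n n))
  | of_succ j hj ih =>
    have hmono : headSubspace K n j ≤ headSubspace K n (j + 1) :=
      fun x hx i hi => hx i (by omega)
    -- Descending from n, either the dimension drops by at least one, or the intersection is stable,
    -- since the map sends head j into head j + 1. A stable subspace of head j is zero.
    by_cases hle : W ⊓ headSubspace K n (j + 1) ≤ headSubspace K n j
    · have hstab : ∀ x ∈ W ⊓ headSubspace K n j, bidiagonal ζ x ∈ W ⊓ headSubspace K n j := by
        intro x hx
        refine ⟨hW x hx.1, hle ⟨hW x hx.1, fun i hi => ?_⟩⟩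
        change ζ i * x i + _ = 0
        rw [hx.2 i (by omega), dif_pos (by omega : 0 < (i : ℕ)),
          hx.2 _ (by simp; omega), mul_zero, add_zero]
      have hall : ∀ t ≤ j, W ⊓ headSubspace K n j ≤ headSubspace K n t := by
        intro t ht
        induction ht using Nat.decreasingInduction with
        | self => exact inf_le_right
        | of_succ t ht ih' =>
          intro x hx i hi
          rcases hi.eq_or_lt with h | h
          · have h1 := ih' (hstab x hx) ⟨t + 1, by omega⟩ le_rfl
            change ζ _ * x _ + _ = 0 at h1
            rw [ih' hx ⟨t + 1, by omega⟩ le_rfl, dif_pos (Nat.succ_pos t), mul_zero,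
              zero_add] at h1
            rw [← h1]
            congr 1
            exact Fin.ext h.symm
          · exact ih' hx i h
      have hbot : W ⊓ headSubspace K n j = ⊥ := (Submodule.eq_bot_iff _).2 fun x hx =>
        funext fun i => hall 0 (Nat.zero_le _) hx i (Nat.zero_le _)
      rw [hbot, finrank_bot]
      exact Nat.zero_le _
    · have hlt : W ⊓ headSubspace K n j < W ⊓ headSubspace K n (j + 1) :=
        lt_of_le_of_ne (inf_le_inf_left W hmono) fun h => hle (h ▸ inf_le_right)
      have := Submodule.finrank_lt_finrank_of_lt hlt
      omega

/-- Semisimplicity gives a stable complement to each tail. The component of e_i there is an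
eigenvector with leading coordinate 1, since its error term lies in both the tail and the
complement. These eigenvectors form a unipotent triangular matrix, even when eigenvalues repeat. -/
theorem exists_isConj_diagonal_of_isSemisimple {s : End K (Fin n → K)} (hs : s.IsSemisimple)
    {ζ : Fin n → K} (htail : ∀ j, ∀ x ∈ tailSubspace K n j, s x ∈ tailSubspace K n j)
    (hζ : ∀ i : Fin n, ∀ x ∈ tailSubspace K n i, s x i = ζ i * x i) :
    IsConj s (Matrix.toLin' (Matrix.diagonal ζ)) := by
  have hex : ∀ i : Fin n, ∃ v ∈ tailSubspace K n i, v i = 1 ∧ s v = ζ i • v := fun i => by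
    obtain ⟨q, hq, hcompl⟩ := Module.End.isSemisimple_iff.1 hs (tailSubspace K n (i + 1))
      (htail (i + 1))
    have he : (Pi.single i 1 : Fin n → K) ∈ tailSubspace K n i := fun j hj => by
      rw [Pi.single_eq_of_ne (fun h => by rw [h] at hj; exact lt_irrefl _ hj)]
    obtain ⟨g, hg, v, hv, hgv⟩ := Submodule.mem_sup.1
      (hcompl.sup_eq_top ▸ Submodule.mem_top : (Pi.single i 1 : Fin n → K) ∈ _)
    obtain ⟨hg1, hg2⟩ := mem_tailSubspace_succ_iff.1 hg
    have hvt : v ∈ tailSubspace K n i := by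
      rw [← add_sub_cancel_left g v, hgv]
      exact Submodule.sub_mem _ he hg1
    have hvi : v i = 1 := by
      have := congrFun hgv i
      simpa [hg2] using this
    refine ⟨v, hvt, hvi, ?_⟩
    rw [← sub_eq_zero, ← Submodule.mem_bot K, ← hcompl.inf_eq_bot]
    refine ⟨mem_tailSubspace_succ_iff.2 ⟨Submodule.sub_mem _ (htail _ _ hvt)
      (Submodule.smul_mem _ _ hvt), ?_⟩, q.sub_mem (hq hv) (q.smul_mem _ hv)⟩
    rw [Pi.sub_apply, hζ i v hvt]
    simp
  choose v hv1 hv2 hv3 using hex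
  set M : Matrix (Fin n) (Fin n) K := Matrix.of fun i j => v j i
  have hdet : M.det = 1 := by
    rw [Matrix.det_of_isLowerTriangular M fun i j hij => hv1 _ _ hij]
    exact Finset.prod_eq_one fun i _ => hv2 i
  have hunit : IsUnit (Matrix.toLin' M) := by
    have : IsUnit M := (Matrix.isUnit_iff_isUnit_det M).2 (by rw [hdet]; exact isUnit_one)
    exact this.map (Matrix.toLinAlgEquiv' (R := K) (n := Fin n))
  have hcol : ∀ k, Matrix.toLin' M (Pi.single k 1) = v k := fun k => by
    rw [Matrix.toLin'_apply, Matrix.mulVec_single_one]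
    rfl
  obtain ⟨u, hu⟩ := hunit
  refine IsConj.symm ⟨u, ?_⟩
  rw [SemiconjBy, hu]
  refine (Pi.basisFun K (Fin n)).ext fun k => ?_
  have hd : Matrix.toLin' (Matrix.diagonal ζ) (Pi.single k 1) = ζ k • Pi.single k 1 := by
    rw [Matrix.toLin'_apply, Matrix.mulVec_single_one]
    ext i
    by_cases h : i = k
    · subst h; simp
    · simp [h, Matrix.diagonal_apply_ne]
  rw [Pi.basisFun_apply, Module.End.mul_apply, Module.End.mul_apply, hd, map_smul, hcol, hv3]

/-- Both Jordan parts are polynomials in the map, hence preserve the tail flag. The nilpotent part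
has zero diagonal, so the semisimple part inherits the diagonal ζ. -/
theorem exists_isSemisimplePart_bidiagonal [PerfectField K] (ζ : Fin n → K) :
    ∃ s, IsSemisimplePart (bidiagonal ζ) s ∧
      IsConj s (Matrix.toLin' (Matrix.diagonal ζ)) := by
  obtain ⟨ν, hν, s, hs, hnil, hss, hsum⟩ := (bidiagonal ζ).exists_isNilpotent_isSemisimple
  have hsub : bidiagonal ζ - s = ν := by rw [hsum, add_sub_cancel_right]
  have hcomm : Commute s ν := Algebra.commute_of_mem_adjoin_singleton_of_commute hν
    (Algebra.commute_of_mem_adjoin_self hs).symm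
  have htail : ∀ g ∈ Algebra.adjoin K {bidiagonal ζ}, ∀ j, ∀ x ∈ tailSubspace K n j,
      g x ∈ tailSubspace K n j := by
    intro g hg j
    induction hg using Algebra.adjoin_induction with
    | mem g hg =>
      rw [Set.mem_singleton_iff.1 hg]
      exact fun x hx => bidiagonal_mem_tailSubspace ζ j hx
    | algebraMap r => exact fun x hx => Submodule.smul_mem _ r hx
    | add g h _ _ hg hh => exact fun x hx => Submodule.add_mem _ (hg x hx) (hh x hx)
    | mul g h _ _ hg hh => exact fun x hx => hg _ (hh x hx)
  have hdiag : ∀ g : End K (Fin n → K), (∀ j, ∀ x ∈ tailSubspace K n j, g x ∈ tailSubspace K n j) →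
      ∀ i : Fin n, ∃ c : K, ∀ x ∈ tailSubspace K n i, g x i = c * x i := by
    intro g hg i
    refine ⟨g (Pi.single i 1) i, fun x hx => ?_⟩
    have he : (Pi.single i 1 : Fin n → K) ∈ tailSubspace K n i := fun j hj => by
      rw [Pi.single_eq_of_ne (fun h => by rw [h] at hj; exact lt_irrefl _ hj)]
    have h1 := hg _ _ (mem_tailSubspace_succ_iff.2
      ⟨Submodule.sub_mem _ hx (Submodule.smul_mem _ (x i) he), by simp⟩) i (Nat.lt_succ_self _)
    rw [map_sub, map_smul, Pi.sub_apply, Pi.smul_apply, smul_eq_mul, sub_eq_zero] at h1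
    rw [h1, mul_comm]
  refine ⟨s, ⟨hss, hsub.symm ▸ hnil, hsub.symm ▸ hcomm⟩,
    exists_isConj_diagonal_of_isSemisimple hss (htail s hs) fun i x hx => ?_⟩
  have hν0 : ∀ x ∈ tailSubspace K n i, ν x i = 0 := by
    obtain ⟨c, hc⟩ := hdiag ν (htail ν hν) i
    have hpow : ∀ k, ∀ x ∈ tailSubspace K n i,
        (ν ^ k) x ∈ tailSubspace K n i ∧ (ν ^ k) x i = c ^ k * x i := fun k x hx => by
      induction k with
      | zero => simpa using hx
      | succ k ih =>
        rw [pow_succ', Module.End.mul_apply]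
        refine ⟨htail ν hν _ _ ih.1, ?_⟩
        rw [hc _ ih.1, ih.2]
        ring
    obtain ⟨k, hk⟩ := hnil
    intro x hx
    have h1 := (hpow k x hx).2
    rw [hk, LinearMap.zero_apply, Pi.zero_apply, eq_comm, mul_eq_zero] at h1
    rw [hc x hx]
    rcases h1 with h1 | h1
    · rw [by_contra fun h => pow_ne_zero k h h1, zero_mul]
    · rw [h1, mul_zero]
  have := bidiagonal_apply_of_mem_tailSubspace ζ i hx
  rw [hsum, LinearMap.add_apply, Pi.add_apply, hν0 x hx, zero_add] at this
  exact this

end Bidiagonal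

/-! ### Weak admissibility and the polygon inequalities -/

namespace BanachHecke.FilteredIsocrystal

section Bidiagonal

variable {K : Type*} [Field K] {n : ℕ}

/-- The bidiagonal Frobenius together with a flag of type `b` in general position. -/
noncomputable def ofBidiagonal {ζ : Fin n → K} (hζ : ∀ i, ζ i ≠ 0) (b : Fin n → ℤ) :
    FilteredIsocrystal K (Fin n → K) where
  frob := LinearEquiv.ofInjectiveEndo (bidiagonal ζ) (bidiagonal_injective hζ)
  fil c := headSubspace K n (Finset.univ.filter fun i => c ≤ b i).card
  antitone_fil c c' h x hx i hi := hx i ((Finset.card_le_card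
    (Finset.monotone_filter_right _ fun _ _ h' => h.trans h')).trans hi)
  exhaustive x := by
    obtain ⟨c, hc⟩ := (Set.finite_range b).bddBelow
    refine ⟨c, fun i hi => ?_⟩
    rw [Finset.filter_true_of_mem fun i _ => hc ⟨i, rfl⟩, Finset.card_univ, Fintype.card_fin] at hi
    exact absurd i.2 (not_lt.2 hi)
  separated x hx := by
    obtain ⟨c, hc⟩ := (Set.finite_range b).bddAbove
    refine funext fun i => hx (c + 1) i ?_
    rw [Finset.filter_false_of_mem fun i _ => by have := hc ⟨i, rfl⟩; omega, Finset.card_empty]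
    exact Nat.zero_le _

variable {ζ : Fin n → K} (hζ : ∀ i, ζ i ≠ 0) (b : Fin n → ℤ)

theorem coe_frob_ofBidiagonal :
    ((ofBidiagonal hζ b).frob : (Fin n → K) →ₗ[K] (Fin n → K)) = bidiagonal ζ :=
  LinearMap.ext fun _ => rfl

theorem finrank_fil_ofBidiagonal (c : ℤ) :
    finrank K ((ofBidiagonal hζ b).fil c) = (Finset.univ.filter fun i => c ≤ b i).card :=
  finrank_headSubspace K (by simpa using Finset.card_le_univ (Finset.univ.filter fun i => c ≤ b i))

theorem hasType_ofBidiagonal {b : Fin n → ℤ} (hb : Monotone b) :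
    (ofBidiagonal hζ b).HasType b := by
  refine ⟨hb, fun c => ?_⟩
  have h := (ofBidiagonal hζ b).grDim_add_finrank c
  rw [finrank_fil_ofBidiagonal, finrank_fil_ofBidiagonal] at h
  have h' : (Finset.univ.filter fun i => c ≤ b i).card = (Finset.univ.filter fun i => b i = c).card
      + (Finset.univ.filter fun i => c + 1 ≤ b i).card := by
    rw [← Finset.card_union_of_disjoint (Finset.disjoint_filter.2 fun i _ h1 h2 => by omega),
      ← Finset.filter_or]
    congr 1
    ext i
    simp only [Finset.mem_filter, Finset.mem_univ, true_and]
    omega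
  omega

end Bidiagonal

section Admissible

variable {p : ℕ} [Fact p.Prime] {K : Type*} [NormedField K] [NormedAlgebra ℚ_[p] K]
  {L : IntermediateField ℚ_[p] K} {π : Lˣ}

theorem tN_restrict {V : Type*} [AddCommGroup V] [Module K V] [FiniteDimensional K V]
    (D : FilteredIsocrystal K V) (W : Submodule K V) (hW : ∀ x ∈ W, D.frob x ∈ W) :
    (D.restrict W hW).tN π
      = valL π (LinearMap.det ((D.frob : V →ₗ[K] V).restrict hW)) := by
  rw [tN]
  rfl

variable {n : ℕ} {ζ : Fin n → K} {b : Fin n → ℤ}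

/-- Every invariant subspace attains the minimal t_H for its dimension, while its t_N is the sum
over some set A of that size; the assumed inequality for A compares them. -/
theorem isWeaklyAdmissible_ofBidiagonal (hζ : ∀ i, ζ i ≠ 0) (hb : Monotone b)
    (hle : ∀ A : Finset (Fin n), ∑ i with Fin.val i < A.card, (b i : ℝ) ≤ ∑ i ∈ A, valL π (ζ i))
    (heq : ∑ i, valL π (ζ i) = ∑ i, (b i : ℝ)) :
    (ofBidiagonal hζ b).IsWeaklyAdmissible π := by
  have htype := hasType_ofBidiagonal hζ hb
  have hn : finrank K (Fin n → K) = n := finrank_fin_fun K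
  refine ⟨?_, fun W hW => ?_⟩
  · rw [htype.tH_eq_sum hn, tN, coe_frob_ofBidiagonal, det_bidiagonal,
      valL_prod _ fun i _ => hζ i, heq]
    push_cast
    rfl
  · obtain ⟨A, hcard, hdet⟩ := exists_det_restrict_bidiagonal_eq_prod ζ hW
    have h1 := htype.tH_restrict_le_sum hn W hW fun c => by
      rw [finrank_fil_ofBidiagonal]
      exact finrank_inf_headSubspace_le ζ hW
        (by simpa using Finset.card_le_univ (Finset.univ.filter fun i => c ≤ b i))
    have h3 : (((ofBidiagonal hζ b).restrict W hW).tH : ℝ)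
        ≤ ∑ i with Fin.val i < finrank K W, (b i : ℝ) := by exact_mod_cast h1
    refine h3.trans ?_
    rw [tN_restrict, ← hcard]
    refine (hle A).trans_eq ?_
    rw [← valL_prod _ fun i _ => hζ i, ← hdet]
    rfl

/-- Apply admissibility to an invariant subspace realizing A, and bound its t_H below by the generic
value. The full set gives the whole space and thus equality. -/
theorem IsWeaklyAdmissible.sum_le_and_sum_eq {D : FilteredIsocrystal K (Fin n → K)}
    (hD : D.IsWeaklyAdmissible π) (htype : D.HasType b) (hζ : ∀ i, ζ i ≠ 0)
    (hfrob : Matrix.toLin' (Matrix.diagonal ζ) ∈ D.frobeniusType) :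
    (∀ A : Finset (Fin n), ∑ i with Fin.val i < A.card, (b i : ℝ) ≤ ∑ i ∈ A, valL π (ζ i)) ∧
      ∑ i, valL π (ζ i) = ∑ i, (b i : ℝ) := by
  have hn : finrank K (Fin n → K) = n := finrank_fin_fun K
  obtain ⟨s, ⟨-, hnil, hcomm⟩, u, hu⟩ := hfrob
  have hdiag : ∀ k, Matrix.toLin' (Matrix.diagonal ζ) (Pi.single k 1) = ζ k • Pi.single k 1 := by
    intro k
    rw [Matrix.toLin'_apply, Matrix.mulVec_single_one]
    ext i
    by_cases h : i = k
    · subst h; simp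
    · simp [h, Matrix.diagonal_apply_ne]
  -- The conjugating automorphism u satisfies u s = diag(ζ) u, so u⁻¹ carries the standard basis to
  -- eigenvectors of s.
  have hv : LinearIndependent K fun k : Fin n => (u⁻¹ : (End K (Fin n → K))ˣ).1 (Pi.single k 1) := by
    have := (Pi.basisFun K (Fin n)).linearIndependent.map' (u⁻¹ : (End K (Fin n → K))ˣ).1
      (LinearMap.ker_eq_bot_of_inverse (g := u.1) (by
        rw [← Module.End.mul_eq_comp, Units.mul_inv]; rfl))
    simpa [Function.comp_def] using this
  have hs : ∀ k, s ((u⁻¹ : (End K (Fin n → K))ˣ).1 (Pi.single k 1))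
      = ζ k • (u⁻¹ : (End K (Fin n → K))ˣ).1 (Pi.single k 1) := fun k => by
    rw [← map_smul, ← hdiag, ← Module.End.mul_apply, ← Module.End.mul_apply]
    congr 1
    exact hu.units_inv_symm_left.eq.symm
  have key := exists_invariant_det_restrict_eq_prod hcomm hnil hv hs
  refine ⟨fun A => ?_, ?_⟩
  · obtain ⟨W, hW, hcard, hdet⟩ := key A
    have h1 := htype.sum_le_tH_restrict hn W hW
    rw [hcard] at h1
    have h2 := hD.2 W hW
    rw [tN_restrict, hdet, valL_prod _ fun i _ => hζ i] at h2
    refine le_trans ?_ h2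
    exact_mod_cast h1
  · obtain ⟨W, hW, hcard, hdet⟩ := key Finset.univ
    have htop : W = ⊤ := Submodule.eq_top_of_finrank_eq (by rw [hcard, hn]; simp)
    rw [LinearMap.det_restrict_of_eq_top _ hW htop] at hdet
    have h := hD.1
    rw [htype.tH_eq_sum hn, tN, hdet, valL_prod _ fun i _ => hζ i] at h
    rw [← h]
    push_cast
    rfl

end Admissible

end BanachHecke.FilteredIsocrystal

theorem proposition5p2 (p : ℕ) [Fact p.Prime] (K : Type*) [NormedField K]
    [NormedAlgebra ℚ_[p] K] [IsUltrametricDist K] [CompleteSpace K]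
    (L : IntermediateField ℚ_[p] K) [FiniteDimensional ℚ_[p] L]
    (π : Lˣ) (hπ : BanachHecke.IsPrimeElement π)
    (d : ℕ) (a : Fin (d + 1) → ℤ) (ha : Monotone a)
    (ζ : BanachHecke.DualTorus L (d + 1)) :
    ζ ∈ BanachHecke.affinoidDomain π a ↔
      ∃ D : BanachHecke.FilteredIsocrystal K (Fin (d + 1) → K),
        D.IsWeaklyAdmissible π ∧
        D.HasType (fun i => a i + (i : ℤ) * (Module.finrank ℚ_[p] L : ℤ)) ∧
        Matrix.toLin' (Matrix.diagonal (BanachHecke.coord π a ζ)) ∈ D.frobeniusType := by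
  have hζ : ∀ i, coord π a ζ i ≠ 0 := coord_ne_zero hπ a ζ
  rw [mem_affinoidDomain_iff hπ ha ζ (b := fun i => a i + (i : ℤ) * (finrank ℚ_[p] L : ℤ))
    fun _ => rfl]
  constructor
  · rintro ⟨hle, heq⟩
    -- Characteristic zero makes K perfect, as the Jordan decomposition requires.
    have : CharZero K := charZero_of_injective_algebraMap (algebraMap ℚ_[p] K).injective
    have hb : Monotone fun i : Fin (d + 1) => a i + (i : ℤ) * (finrank ℚ_[p] L : ℤ) :=
      fun i j hij => add_le_add (ha hij)
        (mul_le_mul_of_nonneg_right (by exact_mod_cast hij) (by positivity))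
    refine ⟨.ofBidiagonal hζ _, FilteredIsocrystal.isWeaklyAdmissible_ofBidiagonal hζ hb hle heq,
      FilteredIsocrystal.hasType_ofBidiagonal hζ hb, ?_⟩
    exact exists_isSemisimplePart_bidiagonal (coord π a ζ)
  · rintro ⟨D, hD, htype, hfrob⟩
    exact hD.sum_le_and_sum_eq htype hζ hfrob
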